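/- Let $N\ge 1$ and let $\Omega\subset\mathbb{R}^N$ be a bounded domain (nonempty, open, connected). Put $c_N=\pi^{-N/2}\Gamma(N/2)$ and $\rho_N=2\ln 2+\psi(N/2)-\gamma$, where $\psi=\Gamma'/\Gamma$ and $\gamma$ is the Euler--Mascheroni constant. Let $\mathbb{H}(\Omega)$ be the space of measurable functions $u:\mathbb{R}^N\to\mathbb{R}$ with $u\equiv 0$ in $\mathbb{R}^N\setminus\Omega$ and $\iint_{|x-y|\le 1}\frac{(u(x)-u(y))^2}{|x-y|^N}\,dx\,dy<\infty$, and for $u,w\in\mathbb{H}(\Omega)$ let $$\mathcal{E}_L(u,w)=\frac{c_N}{2}\iint_{|x-y|\le 1}\frac{(u(x)-u(y))(w(x)-w(y))}{|x-y|^N}\,dx\,dy-c_N\iint_{|x-y|\ge 1}\frac{u(x)w(y)}{|x-y|^N}\,dx\,dy+\rho_N\int_{\mathbb{R}^N}uw\,dx$$ be the bilinear form of the logarithmic Laplacian. A function $u\in\mathbb{H}(\Omega)$, not a.e. zero, is a Dirichlet eigenfunction with eigenvalue $\lambda\in\mathbb{R}$ if $\mathcal{E}_L(u,w)=\lambda\int_\Omega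 uw\,dx$ for all $w\in\mathbb{H}(\Omega)$. Then there are a nondecreasing sequence $\lambda_1(\Omega)\le\lambda_2(\Omega)\le\cdots$ of real numbers and eigenfunctions $\phi_j$ with eigenvalue $\lambda_j(\Omega)$, $j=1,2,\dots$, such that $(\phi_j)_j$ is an orthonormal basis of $L^2(\Omega)$. For every such sequence, that is, for the sequence of Dirichlet eigenvalues counted with multiplicity, the counting function $\mathcal{N}(t)=\#\{j:\lambda_j(\Omega)<t\}$ is finite for every $t\in\mathbb{R}$ and satisfies, for every $\delta>0$, $$\lim_{t\to+\infty}\mathcal{N}(t)\,e^{-(\frac N2+\delta)t}=0\qquad\text{and}\qquad\liminf_{t\to+\infty}\mathcal{N}(t)\,e^{-(\frac N2-\delta)t}=+\infty .$$ -/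

import Mathlib

open MeasureTheory Filter
open scoped Topology ENNReal

noncomputable section

namespace LogLaplacian

/-- The constant `c_N = π^{-N/2} Γ(N/2)`. -/
def cConst (N : ℕ) : ℝ :=
  Real.pi ^ (-((N : ℝ) / 2)) * Real.Gamma ((N : ℝ) / 2)

/-- The digamma function `ψ = Γ' / Γ`. -/
def digamma (s : ℝ) : ℝ :=
  logDeriv Real.Gamma s

/-- The constant `ρ_N = 2 ln 2 + ψ(N/2) - γ`. -/
def rhoConst (N : ℕ) : ℝ :=
  2 * Real.log 2 + digamma ((N : ℝ) / 2) - Real.eulerMascheroniConstant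

/-- Pairs of points at distance at most one. -/
def nearPairs (N : ℕ) : Set (EuclideanSpace ℝ (Fin N) × EuclideanSpace ℝ (Fin N)) :=
  {p | ‖p.1 - p.2‖ ≤ 1}

/-- Pairs of points at distance at least one. -/
def farPairs (N : ℕ) : Set (EuclideanSpace ℝ (Fin N) × EuclideanSpace ℝ (Fin N)) :=
  {p | 1 ≤ ‖p.1 - p.2‖}

/-- Membership in the space `ℍ(Ω)`: (Lebesgue) measurable functions on `ℝ^N` that vanish
identically outside `Ω` and satisfy
`∬_{|x-y| ≤ 1} (u(x) - u(y))^2 / |x-y|^N dx dy < ∞`. -/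
structure MemH {N : ℕ} (Ω : Set (EuclideanSpace ℝ (Fin N)))
    (u : EuclideanSpace ℝ (Fin N) → ℝ) : Prop where
  aemeasurable : AEMeasurable u volume
  eq_zero : ∀ x, x ∉ Ω → u x = 0
  energy_finite :
    IntegrableOn (fun p : EuclideanSpace ℝ (Fin N) × EuclideanSpace ℝ (Fin N) =>
      (u p.1 - u p.2) ^ 2 / ‖p.1 - p.2‖ ^ N) (nearPairs N) volume

/-- The inner product
`𝓔(u,w) = (c_N/2) ∬_{|x-y| ≤ 1} (u(x)-u(y)) (w(x)-w(y)) / |x-y|^N dx dy` of `ℍ(Ω)`. -/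
def energy {N : ℕ} (u w : EuclideanSpace ℝ (Fin N) → ℝ) : ℝ :=
  cConst N / 2 * ∫ p in nearPairs N,
    (u p.1 - u p.2) * (w p.1 - w p.2) / ‖p.1 - p.2‖ ^ N

/-- The bilinear form `𝓔_L` of the logarithmic Laplacian. -/
def logEnergy {N : ℕ} (u w : EuclideanSpace ℝ (Fin N) → ℝ) : ℝ :=
  energy u w
    - cConst N * (∫ p in farPairs N, u p.1 * w p.2 / ‖p.1 - p.2‖ ^ N)
    + rhoConst N * ∫ x, u x * w x

/-- `u` is a (nontrivial, weak) eigenfunction, with eigenvalue `μ`, of the logarithmic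
Laplacian in `Ω` with `u = 0` outside `Ω`. -/
structure IsEigenfunction {N : ℕ} (Ω : Set (EuclideanSpace ℝ (Fin N))) (μ : ℝ)
    (u : EuclideanSpace ℝ (Fin N) → ℝ) : Prop where
  memH : MemH Ω u
  ne_zero : ¬ u =ᵐ[volume] 0
  weak_eq : ∀ w, MemH Ω w → logEnergy u w = μ * ∫ x in Ω, u x * w x

/-- `lam 0 ≤ lam 1 ≤ ⋯` is the sequence of all Dirichlet eigenvalues of the logarithmic
Laplacian in `Ω`, repeated according to multiplicity, and `phi 0, phi 1, …` are corresponding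
eigenfunctions which form an orthonormal basis of `L²(Ω)`. -/
structure IsEigenSystem {N : ℕ} (Ω : Set (EuclideanSpace ℝ (Fin N))) (lam : ℕ → ℝ)
    (phi : ℕ → EuclideanSpace ℝ (Fin N) → ℝ) : Prop where
  mono : Monotone lam
  eigen : ∀ i, IsEigenfunction Ω (lam i) (phi i)
  basis : ∃ b : HilbertBasis ℕ ℝ (Lp ℝ 2 (volume.restrict Ω)),
    ∀ i, b i =ᵐ[volume.restrict Ω] phi i

/-- The counting function `𝒩(t) = #{j : λ_j < t}`, with values in `[0, ∞]`. -/
def counting (lam : ℕ → ℝ) (t : ℝ) : ℝ≥0∞ :=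
  ({j : ℕ | lam j < t}.encard : ℝ≥0∞)

end LogLaplacian

end

/-! The form behaves like one with Fourier symbol `2 log |ξ|`: energy below `t` leaves frequencies
up to about `e^{t/2}`, hence roughly `e^{Nt/2}` eigenvalues. The argument stays in physical space.
Since `c_N` times the area of the unit sphere is `2`, the kernel `|x-y|^{-N}` on `h ≤ |x-y| ≤ 1`
contributes `2 log(1/h) ‖u‖²` minus a cross term, while the long range and zero order parts of the
form are bounded on `L²`.

Upper bound (`exists_card_le`). Dropping `|x-y| < h` gives a lower bound for the energy
(`MemH.le_energy`). Summed over `m` functions orthonormal in `L²(Ω)`, the cross terms form a trace,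
at most `m/2` plus half a squared Hilbert–Schmidt norm of order `h^{-N}`
(`sum_integral_annulusKernel_le`). If all energies are at most `t`, choosing `h` comparable to
`e^{-t/2}` makes the logarithm win and gives `m ≤ C e^{Nt/2}`.

Existence. After a shift the form is coercive and closed, and the bound on orthonormal families
makes the embedding into `L²(Ω)` compact (`isCompactOperator_of_orthonormal_card_le`). The spectral
theorem then gives the eigenbasis (`exists_hilbertBasis_of_form`).

Lower bound. A cube in `Ω` holds `m^N` disjoint tents of radius comparable to `1/m`, each of
normalised energy at most `2 log m + C` (`exists_orthonormal_logEnergy_le`). The form is not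
diagonal on the tents, so min-max on their span is avoided: summing the spectral lower bound
`IsEigenSystem.le_shiftedBilin` over them and using Bessel's inequality yields `m^N ≤ 𝒩(t) (t +
const)` with `t = 2 log m + const`. The lost factor, linear in `t`, is absorbed by `δ`. -/

noncomputable section

namespace LogLaplacian

/-! ### Enumeration in increasing order -/

/-- A real function with finite sublevel sets on an infinite type can be enumerated in
nondecreasing order. -/
theorem exists_equiv_nat_monotone {ι : Type*} [Infinite ι] (f : ι → ℝ)
    (hf : ∀ t, {i | f i ≤ t}.Finite) : ∃ e : ℕ ≃ ι, Monotone (f ∘ e) := by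
  have hc : Countable ι := by
    have : (Set.univ : Set ι).Countable := by
      have h : (Set.univ : Set ι) = ⋃ n : ℕ, {i | f i ≤ n} := by
        ext i
        simpa using exists_nat_ge (f i)
      rw [h]
      exact Set.countable_iUnion fun n => (hf n).countable
    exact Set.countable_univ_iff.mp this
  have := Encodable.ofCountable ι
  -- The encoding breaks ties between equal values, so that `g` is injective and pulls back a linear
  -- order with finite initial segments.
  let g : ι → ℝ ×ₗ ℕ := fun i => toLex (f i, Encodable.encode i)
  have hg : Function.Injective g := fun i j h => by
    have := congrArg (fun p => (ofLex p).2) h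
    exact Encodable.encode_injective this
  let : LinearOrder ι := LinearOrder.lift' g hg
  have hle : ∀ i j : ι, i ≤ j → f i ≤ f j := by
    intro i j h
    have h' : g i ≤ g j := h
    rw [Prod.Lex.le_iff] at h'
    rcases h' with h' | h'
    · exact h'.le
    · exact h'.1.le
  have hfin : ∀ j : ι, (Set.Iic j).Finite := fun j =>
    (hf (f j)).subset fun i hi => hle i j hi
  let : LocallyFiniteOrder ι := LocallyFiniteOrder.ofFiniteIcc fun a b =>
    (hfin b).subset Set.Icc_subset_Iic_self
  have : NoMaxOrder ι := ⟨fun a => by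
    obtain ⟨b, hb⟩ := (hfin a).exists_notMem
    exact ⟨b, not_le.mp hb⟩⟩
  obtain ⟨a⟩ : Nonempty ι := inferInstance
  obtain ⟨m, hm⟩ := (hfin a).exists_minimal ⟨a, Set.self_mem_Iic⟩
  let : OrderBot ι :=
    { bot := m
      bot_le := fun x => by
        rcases le_total x a with h | h
        · rcases le_total m x with h' | h'
          · exact h'
          · exact hm.2 h h'
        · exact (show m ≤ a from hm.1).trans h }
  let : SuccOrder ι := LinearLocallyFiniteOrder.succOrder ι
  let : PredOrder ι := LinearLocallyFiniteOrder.predOrder ι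
  let e := (orderIsoNatOfLinearSuccPredArch (ι := ι)).symm
  exact ⟨e.toEquiv, fun i j h => hle _ _ (e.monotone h)⟩

/-! ### Abstract spectral theorem from a bound on orthonormal families -/

section Compact

variable {V L : Type*} [NormedAddCommGroup V] [InnerProductSpace ℝ V] [CompleteSpace V]
  [NormedAddCommGroup L] [InnerProductSpace ℝ L] [CompleteSpace L]

/-- If the length of orthonormal families in the image of a ball is bounded, for every ball,
then the operator is compact. -/
theorem isCompactOperator_of_orthonormal_card_le (J : V →L[ℝ] L)
    (hcount : ∀ t : ℝ, ∃ n : ℕ, ∀ (m : ℕ) (u : Fin m → V), Orthonormal ℝ (fun i => J (u i)) →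
      (∀ i, ‖u i‖ ^ 2 ≤ t) → m ≤ n) : IsCompactOperator J := by
  refine isClosed_setOfPred_isCompactOperator.closure_subset
    (Metric.mem_closure_iff.mpr fun ε hε => ?_) (a := J)
  set r := ε / 2 with hr
  have hr0 : 0 < r := by positivity
  obtain ⟨n, hn⟩ := hcount (1 / r ^ 2)
  -- A family of maximal length is taken; by maximality, `J` has norm at most `r` on the orthogonal
  -- complement of the space `W` defined from it.
  let S : Set ℕ := {m | ∃ u : Fin m → V, Orthonormal ℝ (fun i => J (u i)) ∧
      ∀ i, ‖u i‖ ^ 2 ≤ 1 / r ^ 2}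
  have hS : S.Nonempty := ⟨0, fun i => i.elim0, ⟨fun i => i.elim0, fun i => i.elim0⟩,
    fun i => i.elim0⟩
  have hSb : BddAbove S := ⟨n, fun m ⟨u, h1, h2⟩ => hn m u h1 h2⟩
  obtain ⟨u, hu, hut⟩ := Nat.sSup_mem hS hSb
  generalize hm : sSup S = m at u hu hut
  -- With the adjoint here, `w ⊥ W` means exactly that `J w` is orthogonal to every `J (u i)`.
  let W : Submodule ℝ V := Submodule.span ℝ (Set.range fun i => J.adjoint (J (u i)))
  have : FiniteDimensional ℝ W := FiniteDimensional.span_of_finite ℝ (Set.finite_range _)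
  let Q : V →L[ℝ] W := W.orthogonalProjectionOnto
  have hQ : IsCompactOperator Q := by
    have : ProperSpace W := FiniteDimensional.proper ℝ W
    exact (isCompactOperator_id (E := W)).comp_clm Q
  refine ⟨(J ∘L W.subtypeL) ∘L Q, hQ.clm_comp (J ∘L W.subtypeL), ?_⟩
  rw [dist_eq_norm]
  refine lt_of_le_of_lt (ContinuousLinearMap.opNorm_le_bound _ hr0.le fun v => ?_)
    (half_lt_self hε)
  set w : V := v - Q v with hw
  have hwv : (J - (J ∘L W.subtypeL) ∘L Q) v = J w := by simp [hw]
  have hwW : w ∈ Wᗮ := W.sub_starProjection_mem_orthogonal v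
  have hwn : ‖w‖ ≤ ‖v‖ := by
    have h1 : inner ℝ (Q v : V) w = 0 := hwW _ (Q v).2
    have h2 : v = Q v + w := by simp [hw]
    have h3 := norm_add_sq_eq_norm_sq_add_norm_sq_of_inner_eq_zero (Q v : V) w h1
    rw [← h2] at h3
    nlinarith [norm_nonneg v, norm_nonneg w, norm_nonneg (Q v : V)]
  rw [hwv]
  by_contra! hlt
  have hJw : 0 < ‖J w‖ := lt_of_le_of_lt (by positivity) hlt
  have horth : ∀ i, inner ℝ (J (u i)) (J w) = 0 := fun i => by
    rw [← ContinuousLinearMap.adjoint_inner_left]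
    exact hwW _ (Submodule.subset_span ⟨i, rfl⟩)
  -- The normalised vector `w / ‖J w‖` would extend the family: `r ‖w‖ ≤ r ‖v‖ < ‖J w‖` keeps its
  -- squared norm within `1 / r²`.
  have hmem : m + 1 ∈ S := by
    refine ⟨Fin.snoc u (‖J w‖⁻¹ • w), ?_, ?_⟩
    · rw [orthonormal_iff_ite]
      rw [orthonormal_iff_ite] at hu
      intro i j
      induction i using Fin.lastCases with
      | last =>
        induction j using Fin.lastCases with
        | last =>
          have h1 : ‖‖J w‖⁻¹ • J w‖ = 1 := by
            rw [norm_smul, norm_inv, norm_norm, inv_mul_cancel₀ hJw.ne']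
          simp only [Fin.snoc_last, map_smul, if_true, real_inner_self_eq_norm_sq, h1, one_pow]
        | cast j =>
          simp [inner_smul_left, real_inner_comm, horth, (Fin.castSucc_lt_last j).ne']
      | cast i =>
        induction j using Fin.lastCases with
        | last => simp [inner_smul_right, horth, (Fin.castSucc_lt_last i).ne]
        | cast j => simpa using hu i j
    · intro i
      induction i using Fin.lastCases with
      | last =>
        simp only [Fin.snoc_last, norm_smul, norm_inv, norm_norm]
        have h1 : r * ‖w‖ ≤ ‖J w‖ := (mul_le_mul_of_nonneg_left hwn hr0.le).trans hlt.le
        have h2 : ‖J w‖⁻¹ * ‖w‖ ≤ 1 / r := by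
          rw [inv_mul_le_iff₀ hJw, mul_one_div, le_div_iff₀ hr0, mul_comm]
          exact h1
        calc (‖J w‖⁻¹ * ‖w‖) ^ 2 ≤ (1 / r) ^ 2 := by gcongr
          _ = 1 / r ^ 2 := by rw [div_pow, one_pow]
      | cast i => simpa using hut i
  have := le_csSup hSb hmem
  omega

/-- Simultaneous diagonalisation of the two inner products, for a compact embedding with dense
range. -/
theorem exists_hilbertBasis_of_count (J : V →L[ℝ] L) (hJ : DenseRange J)
    (hcount : ∀ t : ℝ, ∃ n : ℕ, ∀ (m : ℕ) (u : Fin m → V), Orthonormal ℝ (fun i => J (u i)) →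
      (∀ i, ‖u i‖ ^ 2 ≤ t) → m ≤ n) (hinf : ¬ FiniteDimensional ℝ L) :
    ∃ (lam : ℕ → ℝ) (u : ℕ → V) (b : HilbertBasis ℕ ℝ L), Monotone lam ∧
      ∀ i, b i = J (u i) ∧ ∀ w, inner ℝ (u i) w = lam i * inner ℝ (J (u i)) (J w) := by
  classical
  -- `T = J J*` is compact, symmetric and positive, and injective because `J` has dense range.
  let T : L →L[ℝ] L := J ∘L J.adjoint
  have hTc : IsCompactOperator T :=
    (isCompactOperator_of_orthonormal_card_le J hcount).comp_clm J.adjoint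
  have hTi : ∀ x y, inner ℝ (T x) y = inner ℝ (J.adjoint x) (J.adjoint y) := fun x y => by
    simp [T, ContinuousLinearMap.adjoint_inner_right]
  have hTs : (T : L →ₗ[ℝ] L).IsSymmetric := fun x y => by
    change inner ℝ (T x) y = inner ℝ x (T y)
    rw [real_inner_comm (T y) x, hTi, hTi, real_inner_comm]
  have hinj : ∀ x, J.adjoint x = 0 → x = 0 := fun x hx => by
    refine hJ.eq_zero_of_inner_left (𝕜 := ℝ) ?_
    intro v
    rw [← ContinuousLinearMap.adjoint_inner_left, hx, inner_zero_left]
  let G : ℝ → Submodule ℝ L := fun μ => Module.End.eigenspace (T : Module.End ℝ L) μ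
  have hG : ∀ μ x, x ∈ G μ ↔ T x = μ • x := fun μ x => Module.End.mem_eigenspace_iff
  have hG0 : G 0 = ⊥ := by
    rw [Submodule.eq_bot_iff]
    intro x hx
    rw [hG, zero_smul] at hx
    apply hinj
    have := hTi x x
    rw [hx, inner_zero_left, real_inner_self_eq_norm_sq] at this
    simpa using this.symm
  have hfd : ∀ μ, FiniteDimensional ℝ (G μ) := fun μ => by
    by_cases hμ : μ = 0
    · rw [hμ, hG0]; infer_instance
    · exact ContinuousLinearMap.finite_dimensional_eigenspace hTc μ hμ
  let ι := Σ μ : ℝ, Fin (Module.finrank ℝ (G μ))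
  let v : ι → L := fun i => (stdOrthonormalBasis ℝ (G i.1) i.2 : G i.1)
  have hv : Orthonormal ℝ v :=
    hTs.orthogonalFamily_eigenspaces.orthonormal_sigma_orthonormal
      (v_family := fun μ i => stdOrthonormalBasis ℝ (G μ) i)
      (fun μ => (stdOrthonormalBasis ℝ (G μ)).orthonormal)
  have hvG : ∀ i : ι, T (v i) = i.1 • v i := fun i =>
    (hG _ _).mp (stdOrthonormalBasis ℝ (G i.1) i.2).2
  have hspan : (Submodule.span ℝ (Set.range v))ᗮ = ⊥ := by
    rw [eq_bot_iff, ← ContinuousLinearMap.orthogonalComplement_iSup_eigenspaces_eq_bot hTc hTs]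
    refine Submodule.orthogonal_le (iSup_le fun μ x hx => ?_)
    have h1 := (stdOrthonormalBasis ℝ (G μ)).sum_repr ⟨x, hx⟩
    have h2 := congrArg (Submodule.subtype _) h1
    simp only [map_sum, map_smul, Submodule.subtype_apply] at h2
    rw [← h2]
    exact Submodule.sum_mem _ fun i _ => Submodule.smul_mem _ _
      (Submodule.subset_span ⟨⟨μ, i⟩, rfl⟩)
  have hpos : ∀ i : ι, 0 < i.1 := fun i => by
    have h1 : ‖v i‖ = 1 := hv.1 i
    have h2 : inner ℝ (T (v i)) (v i) = i.1 := by
      rw [hvG, inner_smul_left, real_inner_self_eq_norm_sq, h1]; simp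
    rw [hTi, real_inner_self_eq_norm_sq] at h2
    rw [← h2]
    have : J.adjoint (v i) ≠ 0 := fun h => by
      rw [hinj _ h, norm_zero] at h1
      exact zero_ne_one h1
    positivity
  -- For `T v = μ v`, the vector `μ⁻¹ J* v` is a preimage of `v` and an eigenvector of the form with
  -- eigenvalue `μ⁻¹`, which is also its squared norm. The counting hypothesis therefore bounds the
  -- number of `μ⁻¹ ≤ t`.
  let w : ι → V := fun i => i.1⁻¹ • J.adjoint (v i)
  have hJw : ∀ i, J (w i) = v i := fun i => by
    have : J (w i) = i.1⁻¹ • T (v i) := by simp [w, T]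
    rw [this, hvG, smul_smul, inv_mul_cancel₀ (hpos i).ne', one_smul]
  have hwi : ∀ i x, inner ℝ (w i) x = i.1⁻¹ * inner ℝ (J (w i)) (J x) := fun i x => by
    rw [hJw, ← ContinuousLinearMap.adjoint_inner_left]
    simp [w, inner_smul_left]
  have hfin : ∀ t, {i : ι | i.1⁻¹ ≤ t}.Finite := fun t => by
    obtain ⟨n, hn⟩ := hcount t
    by_contra hInf
    obtain ⟨F, hF, hcard⟩ := Set.Infinite.exists_subset_card_eq hInf (n + 1)
    have e := F.equivFinOfCardEq hcard
    have := hn (n + 1) (fun k => w (e.symm k))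
      (by
        simp only [hJw]
        exact hv.comp (fun k => (e.symm k : ι)) (Subtype.val_injective.comp e.symm.injective))
      (fun k => by
        rw [← real_inner_self_eq_norm_sq, hwi, hJw, real_inner_self_eq_norm_sq, hv.1]
        simpa using hF (e.symm k).2)
    omega
  have : Infinite ι := by
    by_contra hI
    have : Finite ι := not_infinite_iff_finite.mp hI
    apply hinf
    have : FiniteDimensional ℝ (Submodule.span ℝ (Set.range v)) :=
      FiniteDimensional.span_of_finite ℝ (Set.finite_range _)
    have htop : Submodule.span ℝ (Set.range v) = ⊤ := (Submodule.orthogonal_eq_bot_iff).mp hspan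
    rw [htop] at this
    exact Module.finite_def.mpr (Submodule.fg_top _ |>.mp ((Submodule.fg_top _).mpr
      (Module.Finite.iff_fg.mp this)))
  obtain ⟨e, he⟩ := exists_equiv_nat_monotone (fun i : ι => i.1⁻¹) hfin
  have hve : Orthonormal ℝ (v ∘ e) := hv.comp e e.injective
  have hse : (Submodule.span ℝ (Set.range (v ∘ e)))ᗮ = ⊥ := by
    rwa [e.surjective.range_comp]
  refine ⟨fun i => (e i).1⁻¹, w ∘ e, HilbertBasis.mkOfOrthogonalEqBot hve hse, he, fun i => ?_⟩
  refine ⟨?_, fun x => hwi _ _⟩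
  simp [hJw]

end Compact

/-- The spectral theorem for a closed symmetric form on a real vector space which embeds into a
Hilbert space with dense range, under the counting condition of `exists_hilbertBasis_of_count`. -/
theorem exists_hilbertBasis_of_form {V L : Type*} [AddCommGroup V] [Module ℝ V]
    [NormedAddCommGroup L] [InnerProductSpace ℝ L] [CompleteSpace L]
    (a : V → V → ℝ) (hsymm : ∀ u w, a u w = a w u)
    (hadd : ∀ u v w, a (u + v) w = a u w + a v w)
    (hsmul : ∀ (r : ℝ) u w, a (r • u) w = r * a u w)
    (J : V →ₗ[ℝ] L) (hJa : ∀ u, ‖J u‖ ^ 2 ≤ a u u) (hJ : DenseRange J)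
    (hcomplete : ∀ u : ℕ → V,
      (∀ ε > 0, ∃ M, ∀ n ≥ M, ∀ m ≥ M, a (u n - u m) (u n - u m) < ε) →
      ∃ v, ∀ ε > 0, ∃ M, ∀ n ≥ M, a (u n - v) (u n - v) < ε)
    (hcount : ∀ t : ℝ, ∃ n : ℕ, ∀ (m : ℕ) (u : Fin m → V), Orthonormal ℝ (fun i => J (u i)) →
      (∀ i, a (u i) (u i) ≤ t) → m ≤ n) (hinf : ¬ FiniteDimensional ℝ L) :
    ∃ (lam : ℕ → ℝ) (u : ℕ → V) (b : HilbertBasis ℕ ℝ L), Monotone lam ∧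
      ∀ i, b i = J (u i) ∧ ∀ w, a (u i) w = lam i * inner ℝ (J (u i)) (J w) := by
  let core : PreInnerProductSpace.Core ℝ V :=
    { inner := a
      conj_inner_symm := fun x y => by simpa using hsymm y x
      re_inner_nonneg := fun x => by simpa using (sq_nonneg _).trans (hJa x)
      add_left := hadd
      smul_left := fun x y r => by simpa using hsmul r x y }
  let : SeminormedAddCommGroup V := InnerProductSpace.Core.toSeminormedAddCommGroup (c := core)
  let : InnerProductSpace ℝ V := InnerProductSpace.ofCore core
  have hin : ∀ u w : V, inner ℝ u w = a u w := fun u w => rfl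
  have hnorm : ∀ u : V, ‖u‖ ^ 2 = a u u := fun u => by
    rw [← hin, real_inner_self_eq_norm_sq]
  have : CompleteSpace V := by
    refine Metric.complete_of_cauchySeq_tendsto fun u hu => ?_
    rw [Metric.cauchySeq_iff] at hu
    obtain ⟨v, hv⟩ := hcomplete u fun ε hε => by
      obtain ⟨M, hM⟩ := hu (√ε) (Real.sqrt_pos.mpr hε)
      refine ⟨M, fun n hn m hm => ?_⟩
      have h := hM n hn m hm
      rw [dist_eq_norm] at h
      rw [← hnorm]
      exact (Real.lt_sqrt (norm_nonneg _)).mp h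
    refine ⟨v, Metric.tendsto_atTop.mpr fun ε hε => ?_⟩
    obtain ⟨M, hM⟩ := hv (ε ^ 2) (by positivity)
    refine ⟨M, fun n hn => ?_⟩
    rw [dist_eq_norm]
    have h := hM n hn
    rw [← hnorm] at h
    exact lt_of_pow_lt_pow_left₀ 2 hε.le h
  let J₁ : V →L[ℝ] L := J.mkContinuous 1 fun u => by
    rw [one_mul]
    refine le_of_sq_le_sq ?_ (norm_nonneg _)
    rw [hnorm]
    exact hJa u
  -- The form is only a seminorm on `V`, whose elements may be functions rather than classes; the
  -- Hilbert space is the separation quotient.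
  let J₂ : SeparationQuotient V →L[ℝ] L := SeparationQuotient.liftCLM J₁ fun x y h =>
    (h.map J₁.continuous).eq
  have hJ₂ : ∀ u : V, J₂ (SeparationQuotient.mk u) = J u := fun u => rfl
  have hsurj : Function.Surjective (SeparationQuotient.mk : V → SeparationQuotient V) :=
    SeparationQuotient.surjective_mk
  obtain ⟨lam, U, b, hmono, hb⟩ := exists_hilbertBasis_of_count J₂
    (by
      refine Dense.mono ?_ hJ
      rintro _ ⟨u, rfl⟩
      exact ⟨SeparationQuotient.mk u, rfl⟩)
    (fun t => by
      obtain ⟨n, hn⟩ := hcount t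
      refine ⟨n, fun m u hu ht => ?_⟩
      choose v hv using fun i => hsurj (u i)
      obtain rfl : u = fun i => SeparationQuotient.mk (v i) := funext fun i => (hv i).symm
      refine hn m v hu fun i => ?_
      rw [← hnorm]
      exact ht i) hinf
  choose v hv using fun i => hsurj (U i)
  obtain rfl : U = fun i => SeparationQuotient.mk (v i) := funext fun i => (hv i).symm
  exact ⟨lam, v, b, hmono, fun i => ⟨(hb i).1, fun w => (hb i).2 (SeparationQuotient.mk w)⟩⟩

/-! ### Normalising constants -/

/-- The volume of the unit ball of `ℝ^N`. -/
def unitBallVolume (N : ℕ) : ℝ :=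
  volume.real (Metric.ball (0 : EuclideanSpace ℝ (Fin N)) 1)

theorem cConst_pos {N : ℕ} (hN : 1 ≤ N) : 0 < cConst N := by
  have : (0 : ℝ) < N := by exact_mod_cast hN
  exact mul_pos (Real.rpow_pos_of_pos Real.pi_pos _) (Real.Gamma_pos_of_pos (by positivity))

theorem unitBallVolume_eq {N : ℕ} (hN : 1 ≤ N) :
    unitBallVolume N = √Real.pi ^ N / Real.Gamma (N / 2 + 1) := by
  have : Nonempty (Fin N) := ⟨⟨0, hN⟩⟩
  have h0 : (0 : ℝ) ≤ √Real.pi ^ N / Real.Gamma (N / 2 + 1) :=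
    div_nonneg (by positivity) (Real.Gamma_nonneg_of_nonneg (by positivity))
  simp [unitBallVolume, Measure.real, EuclideanSpace.volume_ball, ENNReal.toReal_ofReal h0]

theorem unitBallVolume_pos {N : ℕ} (hN : 1 ≤ N) : 0 < unitBallVolume N := by
  rw [unitBallVolume_eq hN]
  exact div_pos (by positivity) (Real.Gamma_pos_of_pos (by positivity))

/-- `N * unitBallVolume N` is the area of the unit sphere. The value `2` is what produces the
leading term `2 log(1/h)`, hence the exponent `N/2`. -/
theorem cConst_mul_unitBallVolume {N : ℕ} (hN : 1 ≤ N) :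
    cConst N * (N * unitBallVolume N) = 2 := by
  have hN' : (0 : ℝ) < N := by exact_mod_cast hN
  have hG : 0 < Real.Gamma ((N : ℝ) / 2) := Real.Gamma_pos_of_pos (by positivity)
  have hpi : Real.pi ^ (-((N : ℝ) / 2)) * √Real.pi ^ N = 1 := by
    rw [Real.sqrt_eq_rpow, ← Real.rpow_natCast, ← Real.rpow_mul Real.pi_pos.le,
      ← Real.rpow_add Real.pi_pos]
    rw [show -((N : ℝ) / 2) + 1 / 2 * N = 0 by ring, Real.rpow_zero]
  rw [unitBallVolume_eq hN, cConst, Real.Gamma_add_one (by positivity)]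
  calc _ = (Real.pi ^ (-((N : ℝ) / 2)) * √Real.pi ^ N) * 2 := by field_simp
    _ = 2 := by rw [hpi, one_mul]

/-! ### Integrals of the truncated radial kernels -/

section Radial

variable {N : ℕ}

/-- Integration of a radial function over an annulus. -/
theorem integral_radial_Icc (hN : 1 ≤ N) {a b : ℝ} (ha : 0 ≤ a) (hab : a ≤ b) {f g : ℝ → ℝ}
    (hfg : ∀ r ∈ Set.Icc a b, r ^ (N - 1) * f r = g r) (hg : IntervalIntegrable g volume a b) :
    Integrable (fun z : EuclideanSpace ℝ (Fin N) => (Set.Icc a b).indicator f ‖z‖) ∧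
    ∫ z : EuclideanSpace ℝ (Fin N), (Set.Icc a b).indicator f ‖z‖ =
      N * unitBallVolume N * ∫ r in a..b, g r := by
  have : Nonempty (Fin N) := ⟨⟨0, hN⟩⟩
  have hae : (fun y : ℝ => y ^ (N - 1) • (Set.Icc a b).indicator f y)
      = (Set.Icc a b).indicator g := by
    ext y
    by_cases hy : y ∈ Set.Icc a b
    · simp [hy, hfg y hy]
    · simp [hy]
  have hg' : IntegrableOn g (Set.Icc a b) := by
    rwa [integrableOn_Icc_iff_integrableOn_Ioc, ← intervalIntegrable_iff_integrableOn_Ioc_of_le hab]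
  constructor
  · rw [integrable_fun_norm_addHaar, finrank_euclideanSpace_fin, hae]
    exact ((integrable_indicator_iff measurableSet_Icc).mpr hg').integrableOn
  · rw [integral_fun_norm_addHaar, finrank_euclideanSpace_fin, hae, nsmul_eq_mul, smul_eq_mul,
      ← mul_assoc]
    congr 1
    have hsub : Set.Icc a b ⊆ Set.Ici 0 := fun x hx => ha.trans hx.1
    rw [← integral_Ici_eq_integral_Ioi, setIntegral_indicator measurableSet_Icc,
      intervalIntegral.integral_of_le hab, ← integral_Icc_eq_integral_Ioc,
      Set.inter_eq_right.mpr hsub]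

/-- The kernel `|z|^{-N}` restricted to the annulus `h ≤ |z| ≤ 1`. -/
def annulusKernel (N : ℕ) (h : ℝ) (z : EuclideanSpace ℝ (Fin N)) : ℝ :=
  (Set.Icc h 1).indicator (fun r => 1 / r ^ N) ‖z‖

/-- The kernel `|z|^{2-N}` restricted to the ball `|z| ≤ h`. -/
def coreKernel (N : ℕ) (h : ℝ) (z : EuclideanSpace ℝ (Fin N)) : ℝ :=
  (Set.Icc 0 h).indicator (fun r => r ^ 2 / r ^ N) ‖z‖

variable {h : ℝ}

theorem pow_pred_mul {N : ℕ} (hN : 1 ≤ N) (r : ℝ) : r ^ (N - 1) * r = r ^ N := by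
  rw [← pow_succ, Nat.sub_add_cancel hN]

theorem annulusKernel_nonneg (hh : 0 < h) (z : EuclideanSpace ℝ (Fin N)) :
    0 ≤ annulusKernel N h z :=
  Set.indicator_nonneg (fun r hr => by have := hh.trans_le hr.1; positivity) _

theorem coreKernel_nonneg (z : EuclideanSpace ℝ (Fin N)) : 0 ≤ coreKernel N h z :=
  Set.indicator_nonneg (fun r hr => by have := hr.1; positivity) _

theorem annulusKernel_neg (z : EuclideanSpace ℝ (Fin N)) :
    annulusKernel N h (-z) = annulusKernel N h z := by
  rw [annulusKernel, norm_neg, annulusKernel]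

theorem coreKernel_neg (z : EuclideanSpace ℝ (Fin N)) :
    coreKernel N h (-z) = coreKernel N h z := by
  rw [coreKernel, norm_neg, coreKernel]

theorem integral_annulusKernel (hN : 1 ≤ N) (hh : 0 < h) (h1 : h ≤ 1) :
    Integrable (annulusKernel N h) ∧
      ∫ z, annulusKernel N h z = N * unitBallVolume N * Real.log (1 / h) := by
  have hI : IntervalIntegrable (fun r : ℝ => r⁻¹) volume h 1 :=
    intervalIntegral.intervalIntegrable_inv (fun x hx => by
      rw [Set.uIcc_of_le h1] at hx
      exact (hh.trans_le hx.1).ne') continuousOn_id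
  have := integral_radial_Icc hN hh.le h1 (f := fun r => 1 / r ^ N) (g := fun r => r⁻¹)
    (fun r hr => by
      have := hh.trans_le hr.1
      rw [← pow_pred_mul hN r]
      field_simp) hI
  rwa [integral_inv_of_pos hh one_pos] at this

/-- In polar coordinates the integrand is `r^{-(N+1)}`. The resulting `h^{-N}` is the source of the
growth `e^{Nt/2}` in the upper bound. -/
theorem integral_annulusKernel_sq (hN : 1 ≤ N) (hh : 0 < h) (h1 : h ≤ 1) :
    Integrable (fun z => annulusKernel N h z ^ 2) ∧
      ∫ z, annulusKernel N h z ^ 2 ≤ unitBallVolume N * (1 / h) ^ N := by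
  have h0 : (0 : ℝ) ∉ Set.uIcc h 1 := fun hx => by
    rw [Set.uIcc_of_le h1] at hx
    exact (hh.trans_le hx.1).ne' rfl
  have hN' : (0 : ℝ) < N := by exact_mod_cast hN
  have hI : IntervalIntegrable (fun r : ℝ => r ^ (-(N + 1 : ℤ))) volume h 1 :=
    intervalIntegral.intervalIntegrable_zpow (Or.inr h0)
  have := integral_radial_Icc hN hh.le h1 (f := fun r => (1 / r ^ N) ^ 2)
    (g := fun r => r ^ (-(N + 1 : ℤ)))
    (fun r hr => by
      have := hh.trans_le hr.1
      rw [zpow_neg, show (N + 1 : ℤ) = ((N + 1 : ℕ) : ℤ) by push_cast; ring, zpow_natCast,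
        pow_succ, ← pow_pred_mul hN r]
      field_simp
      rw [pow_succ, ← pow_pred_mul hN r]
      ring) hI
  rw [integral_zpow (Or.inr ⟨by omega, h0⟩)] at this
  have heq : ∀ z : EuclideanSpace ℝ (Fin N), annulusKernel N h z ^ 2 =
      (Set.Icc h 1).indicator (fun r => (1 / r ^ N) ^ 2) ‖z‖ := fun z => by
    by_cases hz : ‖z‖ ∈ Set.Icc h 1 <;> simp [annulusKernel, hz]
  simp only [heq]
  refine ⟨this.1, this.2.trans_le ?_⟩
  have e1 : (-(N + 1 : ℤ) + 1) = -(N : ℤ) := by ring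
  have e2 : ((-(N + 1 : ℤ) : ℤ) : ℝ) + 1 = -(N : ℝ) := by push_cast; ring
  rw [e1, e2, zpow_neg, zpow_neg, zpow_natCast, zpow_natCast, one_pow, inv_one, div_neg, ← neg_div,
    neg_sub, one_div, inv_pow]
  have : N * unitBallVolume N * (((h ^ N)⁻¹ - 1) / N) = unitBallVolume N * ((h ^ N)⁻¹ - 1) := by
    field_simp
  rw [this]
  have := unitBallVolume_pos hN
  nlinarith

theorem integral_coreKernel (hN : 1 ≤ N) (hh : 0 ≤ h) :
    Integrable (coreKernel N h) ∧
      ∫ z, coreKernel N h z = N * unitBallVolume N * (h ^ 2 / 2) := by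
  have := integral_radial_Icc hN le_rfl hh (f := fun r => r ^ 2 / r ^ N) (g := fun r => r)
    (fun r hr => by
      rcases hr.1.eq_or_lt with rfl | hr
      · simp
      · rw [← pow_pred_mul hN r]
        field_simp) intervalIntegral.intervalIntegrable_id
  rw [integral_id] at this
  simpa using! this

end Radial

/-! ### Integrals against a kernel of the difference -/

section Convolution

variable {G : Type*} [NormedAddCommGroup G] [MeasurableSpace G] [BorelSpace G]
  [SecondCountableTopology G] {μ : Measure G} [SFinite μ] [μ.IsAddLeftInvariant]

/-- The shear `(x, y) ↦ (x, y - x)` preserves the product measure and, `k` being even, turns the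
integrand into a tensor product. -/
theorem integrable_mul_comp_sub [μ.IsNegInvariant] {f k : G → ℝ} (hf : Integrable f μ)
    (hk : Integrable k μ) (hneg : ∀ z, k (-z) = k z) :
    Integrable (fun p : G × G => f p.1 * k (p.1 - p.2)) (μ.prod μ) ∧
      ∫ p : G × G, f p.1 * k (p.1 - p.2) ∂μ.prod μ = (∫ x, f x ∂μ) * ∫ z, k z ∂μ := by
  have hmp := measurePreserving_prod_neg_add μ μ
  have heq : (fun p : G × G => f p.1 * k (p.1 - p.2)) =
      (fun p : G × G => f p.1 * k p.2) ∘ fun z : G × G => (z.1, -z.1 + z.2) := by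
    ext p
    simp only [Function.comp]
    rw [← hneg]
    congr 2
    abel
  have hi := hf.mul_prod hk
  rw [heq]
  refine ⟨hmp.integrable_comp_of_integrable hi, ?_⟩
  have h2 := integral_map (μ := μ.prod μ) hmp.measurable.aemeasurable
    (f := fun p : G × G => f p.1 * k p.2) (by rw [hmp.map_eq]; exact hi.aestronglyMeasurable)
  rw [hmp.map_eq, integral_prod_mul] at h2
  exact h2.symm

theorem integrable_mul_comp_sub' [μ.IsNegInvariant] {f k : G → ℝ} (hf : Integrable f μ)
    (hk : Integrable k μ) (hneg : ∀ z, k (-z) = k z) :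
    Integrable (fun p : G × G => f p.2 * k (p.1 - p.2)) (μ.prod μ) ∧
      ∫ p : G × G, f p.2 * k (p.1 - p.2) ∂μ.prod μ = (∫ x, f x ∂μ) * ∫ z, k z ∂μ := by
  obtain ⟨h1, h2⟩ := integrable_mul_comp_sub hf hk hneg
  have heq : (fun p : G × G => f p.2 * k (p.1 - p.2)) =
      (fun p : G × G => f p.1 * k (p.1 - p.2)) ∘ Prod.swap := by
    ext p
    simp only [Function.comp, Prod.fst_swap, Prod.snd_swap]
    rw [← hneg, neg_sub]
  refine ⟨heq ▸ h1.swap, ?_⟩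
  rw [← h2, heq]
  exact integral_prod_swap (fun p : G × G => f p.1 * k (p.1 - p.2))

end Convolution

/-! ### The space `ℍ(Ω)` and its embedding in `L²` -/

section Form

variable {N : ℕ} {Ω : Set (EuclideanSpace ℝ (Fin N))}
  {u v w : EuclideanSpace ℝ (Fin N) → ℝ}

theorem measurableSet_nearPairs (N : ℕ) : MeasurableSet (nearPairs N) :=
  measurableSet_le (by fun_prop) measurable_const

theorem measurableSet_farPairs (N : ℕ) : MeasurableSet (farPairs N) :=
  measurableSet_le measurable_const (by fun_prop)

/-- The difference quotient `(u(x) - u(y)) / |x - y|^{N/2}`. -/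
def diffQuot (u : EuclideanSpace ℝ (Fin N) → ℝ)
    (p : EuclideanSpace ℝ (Fin N) × EuclideanSpace ℝ (Fin N)) : ℝ :=
  (u p.1 - u p.2) / √(‖p.1 - p.2‖ ^ N)

theorem diffQuot_mul (u w : EuclideanSpace ℝ (Fin N) → ℝ)
    (p : EuclideanSpace ℝ (Fin N) × EuclideanSpace ℝ (Fin N)) :
    diffQuot u p * diffQuot w p = (u p.1 - u p.2) * (w p.1 - w p.2) / ‖p.1 - p.2‖ ^ N := by
  rw [diffQuot, diffQuot, div_mul_div_comm, Real.mul_self_sqrt (by positivity)]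

theorem diffQuot_sq (u : EuclideanSpace ℝ (Fin N) → ℝ)
    (p : EuclideanSpace ℝ (Fin N) × EuclideanSpace ℝ (Fin N)) :
    diffQuot u p ^ 2 = (u p.1 - u p.2) ^ 2 / ‖p.1 - p.2‖ ^ N := by
  rw [sq, diffQuot_mul, sq]

theorem diffQuot_add : diffQuot (u + w) = diffQuot u + diffQuot w := by
  ext p
  simp only [diffQuot, Pi.add_apply]
  ring

theorem diffQuot_sub : diffQuot (u - w) = diffQuot u - diffQuot w := by
  ext p
  simp only [diffQuot, Pi.sub_apply]
  ring

theorem diffQuot_smul (r : ℝ) : diffQuot (r • u) = r • diffQuot u := by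
  ext p
  simp only [diffQuot, Pi.smul_apply, smul_eq_mul]
  ring

theorem aemeasurable_fst (hu : AEMeasurable u volume) :
    AEMeasurable (fun p : EuclideanSpace ℝ (Fin N) × EuclideanSpace ℝ (Fin N) => u p.1) volume :=
  hu.comp_quasiMeasurePreserving Measure.quasiMeasurePreserving_fst

theorem aemeasurable_snd (hu : AEMeasurable u volume) :
    AEMeasurable (fun p : EuclideanSpace ℝ (Fin N) × EuclideanSpace ℝ (Fin N) => u p.2) volume :=
  hu.comp_quasiMeasurePreserving Measure.quasiMeasurePreserving_snd

theorem aemeasurable_diffQuot (hu : AEMeasurable u volume) :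
    AEMeasurable (diffQuot u) volume :=
  ((aemeasurable_fst hu).sub (aemeasurable_snd hu)).div (Measurable.aemeasurable (by fun_prop))

/-- Written as square integrability of a quotient linear in `u`, the energy condition inherits the
vector space structure of `L²`. -/
theorem memH_iff : MemH Ω u ↔ AEMeasurable u volume ∧ (∀ x, x ∉ Ω → u x = 0) ∧
    MemLp (diffQuot u) 2 (volume.restrict (nearPairs N)) := by
  have key (hu : AEMeasurable u volume) : MemLp (diffQuot u) 2 (volume.restrict (nearPairs N)) ↔
      IntegrableOn (fun p : EuclideanSpace ℝ (Fin N) × EuclideanSpace ℝ (Fin N) =>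
      (u p.1 - u p.2) ^ 2 / ‖p.1 - p.2‖ ^ N) (nearPairs N) volume := by
    rw [memLp_two_iff_integrable_sq (aemeasurable_diffQuot hu).aestronglyMeasurable.restrict]
    simp only [diffQuot_sq, IntegrableOn]
  exact ⟨fun h => ⟨h.1, h.2, (key h.1).mpr h.3⟩, fun h => ⟨h.1, h.2.1, (key h.1).mp h.2.2⟩⟩

theorem MemH.memLp_diffQuot (hu : MemH Ω u) :
    MemLp (diffQuot u) 2 (volume.restrict (nearPairs N)) := (memH_iff.mp hu).2.2

theorem memH_zero : MemH Ω (0 : EuclideanSpace ℝ (Fin N) → ℝ) := by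
  refine memH_iff.mpr ⟨aemeasurable_const, fun _ _ => rfl, ?_⟩
  have : diffQuot (0 : EuclideanSpace ℝ (Fin N) → ℝ) = 0 := by ext p; simp [diffQuot]
  rw [this]
  exact MemLp.zero

theorem MemH.add (hu : MemH Ω u) (hw : MemH Ω w) : MemH Ω (u + w) :=
  memH_iff.mpr ⟨hu.1.add hw.1, fun x hx => by simp [hu.2 x hx, hw.2 x hx], by
    rw [diffQuot_add]; exact hu.memLp_diffQuot.add hw.memLp_diffQuot⟩

theorem MemH.sub (hu : MemH Ω u) (hw : MemH Ω w) : MemH Ω (u - w) :=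
  memH_iff.mpr ⟨hu.1.sub hw.1, fun x hx => by simp [hu.2 x hx, hw.2 x hx], by
    rw [diffQuot_sub]; exact hu.memLp_diffQuot.sub hw.memLp_diffQuot⟩

theorem MemH.smul (r : ℝ) (hu : MemH Ω u) : MemH Ω (r • u) :=
  memH_iff.mpr ⟨hu.1.const_smul r, fun x hx => by simp [hu.2 x hx], by
    rw [diffQuot_smul]; exact hu.memLp_diffQuot.const_smul r⟩

/-- The space `ℍ(Ω)` as a subspace of the space of all functions. -/
def memHSubmodule (Ω : Set (EuclideanSpace ℝ (Fin N))) :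
    Submodule ℝ (EuclideanSpace ℝ (Fin N) → ℝ) where
  carrier := {u | MemH Ω u}
  add_mem' := MemH.add
  zero_mem' := memH_zero
  smul_mem' r _ := MemH.smul r

/-- Functions in `ℍ(Ω)` are square integrable: some translate differs from `u` by a square
integrable function, and iterating this translation moves `Ω` off itself. -/
theorem MemH.memLp (hN : 1 ≤ N) (hΩ : MeasurableSet Ω) (hb : Bornology.IsBounded Ω)
    (hu : MemH Ω u) : MemLp u 2 volume := by
  have : Nonempty (Fin N) := ⟨⟨0, hN⟩⟩
  have hmp := measurePreserving_prod_add (volume : Measure (EuclideanSpace ℝ (Fin N)))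
    (volume : Measure (EuclideanSpace ℝ (Fin N)))
  have h1 := hu.energy_finite
  rw [← integrable_indicator_iff (measurableSet_nearPairs N), Measure.volume_eq_prod] at h1
  have h2 := hmp.integrable_comp_of_integrable h1
  have h3 := h2.prod_left_ae
  -- By Fubini almost every translation is admissible; positive measure of the punctured ball
  -- supplies one that is nonzero and shorter than `1`.
  have hpos : (volume : Measure (EuclideanSpace ℝ (Fin N))) (Metric.ball 0 1 \ {0}) ≠ 0 := by
    rw [measure_sdiff_null (measure_singleton _)]
    exact (Metric.measure_ball_pos _ _ one_pos).ne'
  obtain ⟨z, ⟨hz1, hz0⟩, hz⟩ : ∃ z ∈ Metric.ball (0 : EuclideanSpace ℝ (Fin N)) 1 \ {0},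
      Integrable (fun x => ((nearPairs N).indicator
        (fun p : EuclideanSpace ℝ (Fin N) × EuclideanSpace ℝ (Fin N) =>
          (u p.1 - u p.2) ^ 2 / ‖p.1 - p.2‖ ^ N) ∘
        fun q : EuclideanSpace ℝ (Fin N) × EuclideanSpace ℝ (Fin N) => (q.1, q.1 + q.2)) (x, z))
        volume := by
    by_contra! hcon
    exact hpos (measure_mono_null (fun z hz => hcon z hz) h3)
  have hz0' : 0 < ‖z‖ := norm_pos_iff.mpr hz0
  have hmpz (k : ℕ) : MeasurePreserving (fun x : EuclideanSpace ℝ (Fin N) => x + k • z)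
      volume volume := measurePreserving_add_right _ _
  have hv : MemLp (fun x => u x - u (x + z)) 2 volume := by
    have hm : AEStronglyMeasurable (fun x => u x - u (x + z)) volume := by
      have := (hmpz 1).quasiMeasurePreserving
      simp only [one_smul] at this
      exact (hu.1.sub (hu.1.comp_quasiMeasurePreserving this)).aestronglyMeasurable
    rw [memLp_two_iff_integrable_sq hm]
    refine (hz.mul_const (‖z‖ ^ N)).congr (ae_of_all _ fun x => ?_)
    have hmem : (x, x + z) ∈ nearPairs N := by
      rw [mem_ball_zero_iff] at hz1
      simpa [nearPairs] using hz1.le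
    simp only [Function.comp, Set.indicator_of_mem hmem]
    simp only [sub_add_cancel_left, norm_neg]
    field_simp
  obtain ⟨R, hR⟩ := hb.exists_norm_le
  -- Here `K ‖z‖ > 2R`, more than the diameter of `Ω`, so the telescoping sum ends at a zero of `u`.
  obtain ⟨K, hK⟩ := exists_nat_gt (2 * R / ‖z‖)
  have hsum : MemLp (fun x => ∑ k ∈ Finset.range K, (u (x + k • z) - u (x + k • z + z))) 2 volume :=
    memLp_finsetSum _ fun k _ => hv.comp_measurePreserving (hmpz k)
  refine (hsum.indicator hΩ).ae_eq (ae_of_all _ fun x => ?_)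
  by_cases hx : x ∈ Ω
  · have h0 : u (x + K • z) = 0 := hu.2 _ fun hmem => by
      have h4 : ‖K • z‖ ≤ R + R := by
        calc ‖K • z‖ = ‖(x + K • z) - x‖ := by rw [add_sub_cancel_left]
          _ ≤ R + R := (norm_sub_le _ _).trans (add_le_add (hR _ hmem) (hR _ hx))
      rw [div_lt_iff₀ hz0'] at hK
      rw [← Nat.cast_smul_eq_nsmul ℝ, norm_smul, Real.norm_natCast] at h4
      linarith
    simp only [Set.indicator_of_mem hx]
    have h5 : ∀ k : ℕ, x + k • z + z = x + (k + 1) • z := fun k => by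
      rw [succ_nsmul, add_assoc]
    simp only [h5]
    rw [Finset.sum_range_sub' (fun k : ℕ => u (x + k • z)), h0]
    simp
  · simp [hx, hu.2 x hx]

end Form

/-! ### Fatou's lemma for `L²` bounds -/

theorem eLpNorm_two_eq {α : Type*} [MeasurableSpace α] {μ : Measure α} {f : α → ℝ}
    (hf : MemLp f 2 μ) : eLpNorm f 2 μ = ENNReal.ofReal √(∫ x, f x ^ 2 ∂μ) := by
  rw [hf.eLpNorm_eq_integral_rpow_norm two_ne_zero ENNReal.ofNat_ne_top, Real.sqrt_eq_rpow]
  simp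

/-- Fatou's lemma in `L²`. -/
theorem memLp_two_of_tendsto_ae {α : Type*} [MeasurableSpace α] {μ : Measure α} {f : ℕ → α → ℝ}
    {g : α → ℝ} {B : ℝ} (hf : ∀ n, MemLp (f n) 2 μ)
    (hB : ∀ᶠ n in atTop, ∫ x, f n x ^ 2 ∂μ ≤ B)
    (hlim : ∀ᵐ x ∂μ, Tendsto (fun n => f n x) atTop (𝓝 (g x))) :
    MemLp g 2 μ ∧ ∫ x, g x ^ 2 ∂μ ≤ B := by
  have hle : eLpNorm g 2 μ ≤ ENNReal.ofReal √B := by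
    refine (Lp.eLpNorm_lim_le_liminf_eLpNorm (fun n => (hf n).1) g hlim).trans ?_
    refine liminf_le_of_le (by isBoundedDefault) fun b hb => ?_
    obtain ⟨n, h1, h2⟩ := (hb.and hB).exists
    rw [eLpNorm_two_eq (hf n)] at h1
    exact h1.trans (ENNReal.ofReal_le_ofReal (Real.sqrt_le_sqrt h2))
  have hg : MemLp g 2 μ :=
    ⟨aestronglyMeasurable_of_tendsto_ae atTop (fun n => (hf n).1) hlim,
      hle.trans_lt ENNReal.ofReal_lt_top⟩
  have hB0 : 0 ≤ B := by
    obtain ⟨n, hn⟩ := hB.exists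
    exact (integral_nonneg fun _ => sq_nonneg _).trans hn
  refine ⟨hg, ?_⟩
  rw [eLpNorm_two_eq hg, ENNReal.ofReal_le_ofReal_iff (Real.sqrt_nonneg _)] at hle
  exact (Real.sqrt_le_sqrt_iff hB0).mp hle

/-! ### The form `𝓔_L`: bounds, shift and closedness -/

section Form

variable {N : ℕ} {Ω : Set (EuclideanSpace ℝ (Fin N))}
  {u v w : EuclideanSpace ℝ (Fin N) → ℝ}

/-- The long range part of the form `𝓔_L`. -/
def farForm (u w : EuclideanSpace ℝ (Fin N) → ℝ) : ℝ :=
  ∫ p in farPairs N, u p.1 * w p.2 / ‖p.1 - p.2‖ ^ N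

theorem logEnergy_eq (u w : EuclideanSpace ℝ (Fin N) → ℝ) :
    logEnergy u w = energy u w - cConst N * farForm u w + rhoConst N * ∫ x, u x * w x := rfl

theorem energy_eq (u w : EuclideanSpace ℝ (Fin N) → ℝ) :
    energy u w = cConst N / 2 * ∫ p in nearPairs N, diffQuot u p * diffQuot w p := by
  simp only [energy, diffQuot_mul]

theorem energy_self (u : EuclideanSpace ℝ (Fin N) → ℝ) :
    energy u u = cConst N / 2 * ∫ p in nearPairs N, diffQuot u p ^ 2 := by
  simp only [energy_eq, sq]

theorem energy_self_nonneg (hN : 1 ≤ N) (u : EuclideanSpace ℝ (Fin N) → ℝ) : 0 ≤ energy u u := by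
  rw [energy_self]
  have := cConst_pos hN
  exact mul_nonneg (by positivity) (integral_nonneg fun _ => sq_nonneg _)

theorem energy_symm (u w : EuclideanSpace ℝ (Fin N) → ℝ) : energy u w = energy w u := by
  simp only [energy_eq, mul_comm]

theorem farForm_symm (u w : EuclideanSpace ℝ (Fin N) → ℝ) : farForm u w = farForm w u := by
  have hmp : MeasurePreserving (Prod.swap : EuclideanSpace ℝ (Fin N) × EuclideanSpace ℝ (Fin N) →
      EuclideanSpace ℝ (Fin N) × EuclideanSpace ℝ (Fin N)) volume volume :=
    Measure.measurePreserving_swap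
  have h := hmp.setIntegral_preimage_emb MeasurableEquiv.prodComm.measurableEmbedding
    (fun p => u p.1 * w p.2 / ‖p.1 - p.2‖ ^ N) (farPairs N)
  have hpre : Prod.swap ⁻¹' farPairs N = farPairs N := by
    ext p
    simp [farPairs, norm_sub_rev]
  rw [hpre] at h
  rw [farForm, ← h, farForm]
  refine integral_congr_ae (ae_of_all _ fun p => ?_)
  simp only [Prod.fst_swap, Prod.snd_swap, norm_sub_rev p.2 p.1, mul_comm]

theorem logEnergy_symm (u w : EuclideanSpace ℝ (Fin N) → ℝ) : logEnergy u w = logEnergy w u := by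
  simp only [logEnergy_eq, energy_symm u w, farForm_symm u w, mul_comm]

/-- Standing assumptions: the dimension is positive, and `Ω` is measurable and bounded. -/
structure Admissible {N : ℕ} (Ω : Set (EuclideanSpace ℝ (Fin N))) : Prop where
  one_le : 1 ≤ N
  measurableSet : MeasurableSet Ω
  isBounded : Bornology.IsBounded Ω

theorem Admissible.volume_lt_top (hA : Admissible Ω) : volume Ω < ⊤ :=
  hA.isBounded.measure_lt_top

theorem MemH.memLp_two (hA : Admissible Ω) (hu : MemH Ω u) : MemLp u 2 volume :=
  hu.memLp hA.1 hA.2 hA.3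

theorem MemH.integrable_mul (hA : Admissible Ω) (hu : MemH Ω u) (hw : MemH Ω w) :
    Integrable (fun x => u x * w x) :=
  (hu.memLp_two hA).integrable_mul (hw.memLp_two hA)

theorem MemH.integrable_sq (hA : Admissible Ω) (hu : MemH Ω u) : Integrable (fun x => u x ^ 2) :=
  (hu.memLp_two hA).integrable_sq

theorem MemH.integrable (hA : Admissible Ω) (hu : MemH Ω u) : Integrable u := by
  have : IsFiniteMeasure (volume.restrict Ω) := ⟨by simpa using hA.volume_lt_top⟩
  have h : IntegrableOn u Ω := ((hu.memLp_two hA).restrict Ω).integrable one_le_two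
  rwa [integrableOn_iff_integrable_of_support_subset] at h
  intro x hx
  by_contra hxΩ
  exact hx (hu.2 x hxΩ)

theorem abs_div_le_of_mem_farPairs {p : EuclideanSpace ℝ (Fin N) × EuclideanSpace ℝ (Fin N)}
    (hp : p ∈ farPairs N) (s : ℝ) : |s / ‖p.1 - p.2‖ ^ N| ≤ |s| := by
  have h1 : (1 : ℝ) ≤ ‖p.1 - p.2‖ ^ N := one_le_pow₀ hp
  rw [abs_div, abs_of_nonneg (zero_le_one.trans h1)]
  exact div_le_self (abs_nonneg _) h1

theorem MemH.integrableOn_far (hA : Admissible Ω) (hu : MemH Ω u) (hw : MemH Ω w) :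
    IntegrableOn (fun p : EuclideanSpace ℝ (Fin N) × EuclideanSpace ℝ (Fin N) =>
      u p.1 * w p.2 / ‖p.1 - p.2‖ ^ N) (farPairs N) volume := by
  have h := ((hu.integrable hA).mul_prod (hw.integrable hA)).norm
  refine (h.integrableOn (s := farPairs N)).mono' ?_ ?_
  · exact (((aemeasurable_fst hu.1).mul (aemeasurable_snd hw.1)).div
      (Measurable.aemeasurable (by fun_prop))).aestronglyMeasurable.restrict
  · filter_upwards [ae_restrict_mem (measurableSet_farPairs N)] with p hp
    exact abs_div_le_of_mem_farPairs hp _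

/-- The kernel is at most `1` at distance at least `1`, and `2|u(x)u(y)| ≤ u(x)² 1_Ω(y) + 1_Ω(x)
u(y)²` because `u` vanishes off `Ω`. -/
theorem MemH.abs_farForm_le (hA : Admissible Ω) (hu : MemH Ω u) :
    |farForm u u| ≤ volume.real Ω * ∫ x, u x ^ 2 := by
  have hsq := hu.integrable_sq hA
  have hone : Integrable (Ω.indicator (1 : EuclideanSpace ℝ (Fin N) → ℝ)) := by
    rw [integrable_indicator_iff hA.2]
    exact integrableOn_const hA.volume_lt_top.ne
  have h1 : Integrable (fun p : EuclideanSpace ℝ (Fin N) × EuclideanSpace ℝ (Fin N) =>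
      (u p.1 ^ 2 * Ω.indicator 1 p.2 + Ω.indicator 1 p.1 * u p.2 ^ 2) / 2) volume :=
    ((hsq.mul_prod hone).add (hone.mul_prod hsq)).div_const 2
  have h2 : ∫ p : EuclideanSpace ℝ (Fin N) × EuclideanSpace ℝ (Fin N),
      (u p.1 ^ 2 * Ω.indicator 1 p.2 + Ω.indicator 1 p.1 * u p.2 ^ 2) / 2 =
      volume.real Ω * ∫ x, u x ^ 2 := by
    rw [integral_div, Measure.volume_eq_prod,
      integral_add (hsq.mul_prod hone) (hone.mul_prod hsq),
      integral_prod_mul (fun x : EuclideanSpace ℝ (Fin N) => u x ^ 2) (Ω.indicator 1),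
      integral_prod_mul (Ω.indicator 1) (fun x : EuclideanSpace ℝ (Fin N) => u x ^ 2),
      integral_indicator_one hA.2]
    ring
  rw [← h2, farForm]
  have hpt : ∀ p : EuclideanSpace ℝ (Fin N) × EuclideanSpace ℝ (Fin N),
      |u p.1 * u p.2| ≤ (u p.1 ^ 2 * Ω.indicator 1 p.2 + Ω.indicator 1 p.1 * u p.2 ^ 2) / 2 := by
    intro p
    by_cases hp1 : p.1 ∈ Ω
    · by_cases hp2 : p.2 ∈ Ω
      · simp only [Set.indicator_of_mem hp1, Set.indicator_of_mem hp2, Pi.one_apply, mul_one,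
          one_mul]
        rw [abs_le]
        constructor <;> nlinarith [sq_nonneg (u p.1 - u p.2), sq_nonneg (u p.1 + u p.2)]
      · simp [hu.2 _ hp2, hp2]
    · simp [hu.2 _ hp1, hp1]
  have hnn : ∀ p : EuclideanSpace ℝ (Fin N) × EuclideanSpace ℝ (Fin N),
      0 ≤ (u p.1 ^ 2 * Ω.indicator 1 p.2 + Ω.indicator 1 p.1 * u p.2 ^ 2) / 2 :=
    fun p => (abs_nonneg _).trans (hpt p)
  calc _ ≤ ∫ p in farPairs N, |u p.1 * u p.2 / ‖p.1 - p.2‖ ^ N| := abs_integral_le_integral_abs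
    _ ≤ ∫ p in farPairs N,
        (u p.1 ^ 2 * Ω.indicator 1 p.2 + Ω.indicator 1 p.1 * u p.2 ^ 2) / 2 := by
      refine setIntegral_mono_on (hu.integrableOn_far hA hu).abs h1.integrableOn
        (measurableSet_farPairs N) fun p hp => ?_
      exact (abs_div_le_of_mem_farPairs hp _).trans (hpt p)
    _ ≤ _ := setIntegral_le_integral h1 (ae_of_all _ hnn)

theorem energy_add_left (hu : MemH Ω u) (hv : MemH Ω v) (hw : MemH Ω w) :
    energy (u + v) w = energy u w + energy v w := by
  have h1 : Integrable (fun p => diffQuot u p * diffQuot w p) (volume.restrict (nearPairs N)) :=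
    hu.memLp_diffQuot.integrable_mul hw.memLp_diffQuot
  have h2 : Integrable (fun p => diffQuot v p * diffQuot w p) (volume.restrict (nearPairs N)) :=
    hv.memLp_diffQuot.integrable_mul hw.memLp_diffQuot
  simp only [energy_eq, diffQuot_add, Pi.add_apply, add_mul]
  rw [integral_add h1 h2, mul_add]

theorem energy_smul_left (r : ℝ) : energy (r • u) w = r * energy u w := by
  simp only [energy_eq, diffQuot_smul, Pi.smul_apply, smul_eq_mul, mul_assoc, integral_const_mul]
  ring

theorem farForm_add_left (hA : Admissible Ω) (hu : MemH Ω u) (hv : MemH Ω v) (hw : MemH Ω w) :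
    farForm (u + v) w = farForm u w + farForm v w := by
  simp only [farForm, Pi.add_apply, add_mul, add_div]
  exact integral_add (hu.integrableOn_far hA hw) (hv.integrableOn_far hA hw)

theorem farForm_smul_left (r : ℝ) : farForm (r • u) w = r * farForm u w := by
  simp only [farForm, Pi.smul_apply, smul_eq_mul, mul_assoc, mul_div_assoc, integral_const_mul]

theorem logEnergy_add_left (hA : Admissible Ω) (hu : MemH Ω u) (hv : MemH Ω v) (hw : MemH Ω w) :
    logEnergy (u + v) w = logEnergy u w + logEnergy v w := by
  simp only [logEnergy_eq, energy_add_left hu hv hw, farForm_add_left hA hu hv hw, Pi.add_apply,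
    add_mul]
  rw [integral_add (hu.integrable_mul hA hw) (hv.integrable_mul hA hw)]
  ring

theorem logEnergy_smul_left (r : ℝ) : logEnergy (r • u) w = r * logEnergy u w := by
  simp only [logEnergy_eq, energy_smul_left, farForm_smul_left, Pi.smul_apply, smul_eq_mul,
    mul_assoc, integral_const_mul]
  ring

/-- A shift which makes the form `𝓔_L` coercive on `ℍ(Ω)`. -/
def shift (Ω : Set (EuclideanSpace ℝ (Fin N))) : ℝ :=
  cConst N * volume.real Ω + |rhoConst N| + 1

theorem shift_pos (hN : 1 ≤ N) : 0 < shift Ω := by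
  have := cConst_pos hN
  unfold shift
  positivity

/-- The form `𝓔_L`, shifted to be coercive. -/
def shiftedForm (Ω : Set (EuclideanSpace ℝ (Fin N)))
    (u w : EuclideanSpace ℝ (Fin N) → ℝ) : ℝ :=
  logEnergy u w + shift Ω * ∫ x, u x * w x

/-- Only the near-diagonal energy is unbounded on `L²`. The spare `1` in `shift` leaves one full
copy of the `L²` norm in `MemH.le_shiftedForm`. -/
theorem MemH.abs_logEnergy_sub_energy_le (hA : Admissible Ω) (hu : MemH Ω u) :
    |logEnergy u u - energy u u| ≤ (shift Ω - 1) * ∫ x, u x ^ 2 := by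
  have hc := cConst_pos hA.1
  have h1 := hu.abs_farForm_le hA
  have h0 : 0 ≤ ∫ x, u x ^ 2 := integral_nonneg fun _ => sq_nonneg _
  have h2 : logEnergy u u - energy u u =
      -(cConst N * farForm u u) + rhoConst N * ∫ x, u x ^ 2 := by
    simp only [logEnergy_eq, sq]
    ring
  rw [h2]
  refine (abs_add_le _ _).trans ?_
  rw [abs_neg, abs_mul, abs_mul, abs_of_pos hc, abs_of_nonneg h0]
  have := mul_le_mul_of_nonneg_left h1 hc.le
  unfold shift
  linarith

theorem MemH.le_shiftedForm (hA : Admissible Ω) (hu : MemH Ω u) :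
    energy u u + ∫ x, u x ^ 2 ≤ shiftedForm Ω u u := by
  have := (abs_le.mp (hu.abs_logEnergy_sub_energy_le hA)).1
  simp only [shiftedForm, ← sq]
  linarith

theorem MemH.shiftedForm_le (hA : Admissible Ω) (hu : MemH Ω u) :
    shiftedForm Ω u u ≤ energy u u + 2 * shift Ω * ∫ x, u x ^ 2 := by
  have := (abs_le.mp (hu.abs_logEnergy_sub_energy_le hA)).2
  have h0 : 0 ≤ ∫ x, u x ^ 2 := integral_nonneg fun _ => sq_nonneg _
  simp only [shiftedForm, ← sq]
  linarith

theorem shiftedForm_symm (u w : EuclideanSpace ℝ (Fin N) → ℝ) :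
    shiftedForm Ω u w = shiftedForm Ω w u := by
  simp only [shiftedForm, logEnergy_symm u w, mul_comm]

theorem shiftedForm_add_left (hA : Admissible Ω) (hu : MemH Ω u) (hv : MemH Ω v)
    (hw : MemH Ω w) : shiftedForm Ω (u + v) w = shiftedForm Ω u w + shiftedForm Ω v w := by
  simp only [shiftedForm, logEnergy_add_left hA hu hv hw, Pi.add_apply, add_mul]
  rw [integral_add (hu.integrable_mul hA hw) (hv.integrable_mul hA hw)]
  ring

theorem shiftedForm_smul_left (r : ℝ) : shiftedForm Ω (r • u) w = r * shiftedForm Ω u w := by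
  simp only [shiftedForm, logEnergy_smul_left, Pi.smul_apply, smul_eq_mul, mul_assoc,
    integral_const_mul]
  ring

/-- The restriction map from `ℍ(Ω)` to `L²(Ω)`. -/
def toL2 (hA : Admissible Ω) : memHSubmodule Ω →ₗ[ℝ] Lp ℝ 2 (volume.restrict Ω) where
  toFun u := ((MemH.memLp_two hA u.2).restrict Ω).toLp
  map_add' _ _ := rfl
  map_smul' _ _ := rfl

theorem coeFn_toL2 (hA : Admissible Ω) (u : memHSubmodule Ω) :
    toL2 hA u =ᵐ[volume.restrict Ω] (u : EuclideanSpace ℝ (Fin N) → ℝ) :=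
  MemLp.coeFn_toLp ((MemH.memLp_two hA u.2).restrict Ω)

theorem MemH.setIntegral_mul (hu : MemH Ω u) : ∫ x in Ω, u x * w x = ∫ x, u x * w x :=
  setIntegral_eq_integral_of_forall_compl_eq_zero fun x hx => by rw [hu.2 x hx, zero_mul]

theorem inner_toL2 (hA : Admissible Ω) (u w : memHSubmodule Ω) :
    inner ℝ (toL2 hA u) (toL2 hA w) = ∫ x, u.1 x * w.1 x := by
  rw [L2.inner_def, ← MemH.setIntegral_mul u.2]
  refine integral_congr_ae ?_
  filter_upwards [coeFn_toL2 hA u, coeFn_toL2 hA w] with x h1 h2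
  rw [h1, h2]
  exact mul_comm _ _

theorem norm_toL2_sq (hA : Admissible Ω) (u : memHSubmodule Ω) :
    ‖toL2 hA u‖ ^ 2 = ∫ x, u.1 x ^ 2 := by
  rw [← real_inner_self_eq_norm_sq, inner_toL2]
  simp only [sq]

/-- The shifted form is closed. -/
theorem exists_limit_of_shiftedForm_cauchy (hA : Admissible Ω) (u : ℕ → memHSubmodule Ω)
    (hu : ∀ ε > 0, ∃ M, ∀ n ≥ M, ∀ m ≥ M,
      shiftedForm Ω (u n - u m : memHSubmodule Ω) (u n - u m : memHSubmodule Ω) < ε) :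
    ∃ v : memHSubmodule Ω, ∀ ε > 0, ∃ M, ∀ n ≥ M,
      shiftedForm Ω (u n - v : memHSubmodule Ω) (u n - v : memHSubmodule Ω) < ε := by
  have hc := cConst_pos hA.1
  have hs := shift_pos hA.1 (Ω := Ω)
  have hcau : CauchySeq fun n => toL2 hA (u n) := by
    refine Metric.cauchySeq_iff.mpr fun ε hε => ?_
    obtain ⟨M, hM⟩ := hu (ε ^ 2) (by positivity)
    refine ⟨M, fun n hn m hm => ?_⟩
    have h1 := MemH.le_shiftedForm hA (u n - u m).2
    have h2 := energy_self_nonneg hA.1 (u n - u m).1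
    have h3 := hM n hn m hm
    rw [dist_eq_norm, ← map_sub]
    refine lt_of_pow_lt_pow_left₀ 2 hε.le ?_
    rw [norm_toL2_sq]
    linarith
  obtain ⟨f, hf⟩ := cauchySeq_tendsto_of_complete hcau
  obtain ⟨σ, hσ, hlim⟩ := (tendstoInMeasure_of_tendsto_Lp hf).exists_seq_tendsto_ae
  have hσt := hσ.tendsto_atTop
  -- The `L²(Ω)` limit is extended by zero, since `MemH` requires vanishing at every point outside
  -- `Ω`.
  set g : EuclideanSpace ℝ (Fin N) → ℝ := Ω.indicator f with hg
  have hlim' : ∀ᵐ x ∂volume, Tendsto (fun k => (u (σ k)).1 x) atTop (𝓝 (g x)) := by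
    have h1 : ∀ᵐ x ∂volume.restrict Ω, ∀ n, toL2 hA (u n) x = (u n).1 x :=
      ae_all_iff.mpr fun n => coeFn_toL2 hA (u n)
    have h2 := (ae_restrict_iff' hA.2).mp (hlim.and h1)
    filter_upwards [h2] with x hx
    by_cases hxΩ : x ∈ Ω
    · simpa [hg, hxΩ, (hx hxΩ).2] using (hx hxΩ).1
    · have h3 : ∀ n, (u n).1 x = 0 := fun n => (u n).2.2 x hxΩ
      simp [hg, hxΩ, h3]
  have hpair : ∀ᵐ p : EuclideanSpace ℝ (Fin N) × EuclideanSpace ℝ (Fin N) ∂volume,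
      Tendsto (fun k => (u (σ k)).1 p.1) atTop (𝓝 (g p.1)) ∧
      Tendsto (fun k => (u (σ k)).1 p.2) atTop (𝓝 (g p.2)) :=
    (Measure.quasiMeasurePreserving_fst.ae hlim').and (Measure.quasiMeasurePreserving_snd.ae hlim')
  -- For fixed `n`, Fatou's lemma as `k → ∞` transfers the Cauchy bound on `u (σ k) - u n` to `g - u
  -- n`, separately for the energy and for the `L²` norm.
  have key : ∀ ε > 0, ∃ M, ∀ n ≥ M,
      (MemLp (diffQuot (g - (u n).1)) 2 (volume.restrict (nearPairs N)) ∧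
        ∫ p in nearPairs N, diffQuot (g - (u n).1) p ^ 2 ≤ 2 * ε / cConst N) ∧
      (MemLp (g - (u n).1) 2 volume ∧ ∫ x, (g - (u n).1) x ^ 2 ≤ ε) := by
    intro ε hε
    obtain ⟨M, hM⟩ := hu ε hε
    refine ⟨M, fun n hn => ⟨?_, ?_⟩⟩
    · refine memLp_two_of_tendsto_ae (f := fun k => diffQuot ((u (σ k)).1 - (u n).1))
        (fun k => ((u (σ k)).2.sub (u n).2).memLp_diffQuot) ?_ ?_
      · filter_upwards [hσt.eventually_ge_atTop M] with k hk
        have h1 := MemH.le_shiftedForm hA (u (σ k) - u n).2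
        have h2 := hM _ hk n hn
        have h3 : 0 ≤ ∫ x, (u (σ k) - u n).1 x ^ 2 := integral_nonneg fun _ => sq_nonneg _
        rw [energy_self] at h1
        rw [le_div_iff₀ hc]
        change cConst N / 2 * (∫ p in nearPairs N, diffQuot ((u (σ k)).1 - (u n).1) p ^ 2)
          + _ ≤ _ at h1
        linarith
      · refine ae_restrict_of_ae ?_
        filter_upwards [hpair] with p hp
        simp only [diffQuot, Pi.sub_apply]
        exact ((hp.1.sub_const _).sub (hp.2.sub_const _)).div_const _
    · refine memLp_two_of_tendsto_ae (f := fun k => (u (σ k)).1 - (u n).1)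
        (fun k => ((u (σ k)).2.sub (u n).2).memLp_two hA) ?_ ?_
      · filter_upwards [hσt.eventually_ge_atTop M] with k hk
        have h1 := MemH.le_shiftedForm hA (u (σ k) - u n).2
        have h2 := hM _ hk n hn
        have h3 := energy_self_nonneg hA.1 (u (σ k) - u n).1
        change _ + ∫ x, ((u (σ k)).1 - (u n).1) x ^ 2 ≤ _ at h1
        linarith
      · filter_upwards [hlim'] with x hx
        exact hx.sub_const _
  have hgH : MemH Ω g := by
    obtain ⟨M, hM⟩ := key 1 one_pos
    obtain ⟨⟨h1, -⟩, h2, -⟩ := hM M le_rfl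
    have h3 : MemH Ω (g - (u M).1) := memH_iff.mpr ⟨h2.1.aemeasurable, fun x hx => by
      simp [hg, hx, (u M).2.2 x hx], h1⟩
    simpa using h3.add (u M).2
  refine ⟨⟨g, hgH⟩, fun ε hε => ?_⟩
  -- With this `η`, the bound `η + 2 * shift Ω * η` on the shifted form equals `ε / 2`.
  obtain ⟨M, hM⟩ := key (ε / (2 * (1 + 2 * shift Ω))) (by positivity)
  refine ⟨M, fun n hn => ?_⟩
  obtain ⟨⟨-, h1⟩, -, h2⟩ := hM n hn
  set η := ε / (2 * (1 + 2 * shift Ω)) with hη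
  have hw : ((u n - ⟨g, hgH⟩ : memHSubmodule Ω) : EuclideanSpace ℝ (Fin N) → ℝ) =
      (-1 : ℝ) • (g - (u n).1) := by
    ext x
    simp
  have h3 := (hgH.sub (u n).2).shiftedForm_le hA
  rw [hw, shiftedForm_smul_left, shiftedForm_symm, shiftedForm_smul_left]
  rw [energy_self] at h3
  rw [le_div_iff₀ hc] at h1
  have h4 : η * (2 * (1 + 2 * shift Ω)) = ε := div_mul_cancel₀ _ (by positivity)
  have h5 := mul_le_mul_of_nonneg_left h2 hs.le
  nlinarith

end Form

/-! ### Upper bound for orthonormal families of bounded energy -/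

section Count

variable {N : ℕ} {Ω : Set (EuclideanSpace ℝ (Fin N))}
  {u v w : EuclideanSpace ℝ (Fin N) → ℝ} {h : ℝ}

theorem measurable_annulusKernel (N : ℕ) (h : ℝ) : Measurable (annulusKernel N h) := by
  have : Measurable ((Set.Icc h 1).indicator fun r : ℝ => 1 / r ^ N) :=
    Measurable.indicator (by fun_prop) measurableSet_Icc
  exact this.comp measurable_norm

theorem MemH.integrable_mul_annulusKernel (hA : Admissible Ω) (hu : MemH Ω u) (hw : MemH Ω w)
    (hh : 0 < h) (h1 : h ≤ 1) :
    Integrable (fun p : EuclideanSpace ℝ (Fin N) × EuclideanSpace ℝ (Fin N) =>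
      u p.1 * w p.2 * annulusKernel N h (p.1 - p.2)) volume := by
  have hk := (integral_annulusKernel hA.1 hh h1).1
  have i1 := (integrable_mul_comp_sub (hu.integrable_sq hA) hk annulusKernel_neg).1
  have i2 := (integrable_mul_comp_sub' (hw.integrable_sq hA) hk annulusKernel_neg).1
  refine (i1.add i2).mono' ?_ (ae_of_all _ fun p => ?_)
  · refine (((aemeasurable_fst hu.1).mul (aemeasurable_snd hw.1)).mul
      ((measurable_annulusKernel N h).comp ?_).aemeasurable).aestronglyMeasurable
    fun_prop
  · have hk0 := annulusKernel_nonneg hh (p.1 - p.2)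
    simp only [Pi.add_apply]
    rw [Real.norm_eq_abs, abs_mul, abs_of_nonneg hk0, ← add_mul]
    refine mul_le_mul_of_nonneg_right ?_ hk0
    rw [abs_le]
    constructor <;> nlinarith [sq_nonneg (u p.1 - w p.2), sq_nonneg (u p.1 + w p.2)]

/-- Splitting off the singular part of the kernel. -/
theorem MemH.le_energy (hA : Admissible Ω) (hu : MemH Ω u) (hh : 0 < h) (h1 : h ≤ 1) :
    2 * Real.log (1 / h) * (∫ x, u x ^ 2) - cConst N *
      (∫ p : EuclideanSpace ℝ (Fin N) × EuclideanSpace ℝ (Fin N),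
        u p.1 * u p.2 * annulusKernel N h (p.1 - p.2)) ≤ energy u u := by
  obtain ⟨hk, hkI⟩ := integral_annulusKernel hA.1 hh h1
  obtain ⟨i1, e1⟩ := integrable_mul_comp_sub (hu.integrable_sq hA) hk annulusKernel_neg
  obtain ⟨i2, e2⟩ := integrable_mul_comp_sub' (hu.integrable_sq hA) hk annulusKernel_neg
  rw [← Measure.volume_eq_prod] at i1 e1 i2 e2
  have i3 := hu.integrable_mul_annulusKernel hA hu hh h1
  have hc := cConst_pos hA.1
  have hcV := cConst_mul_unitBallVolume hA.1
  have i12 : Integrable (fun p : EuclideanSpace ℝ (Fin N) × EuclideanSpace ℝ (Fin N) =>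
      u p.1 ^ 2 * annulusKernel N h (p.1 - p.2) + u p.2 ^ 2 * annulusKernel N h (p.1 - p.2))
      volume := i1.add i2
  have hle : ∫ p : EuclideanSpace ℝ (Fin N) × EuclideanSpace ℝ (Fin N),
      (u p.1 ^ 2 * annulusKernel N h (p.1 - p.2) + u p.2 ^ 2 * annulusKernel N h (p.1 - p.2)
        - 2 * (u p.1 * u p.2 * annulusKernel N h (p.1 - p.2))) ≤
      ∫ p in nearPairs N, diffQuot u p ^ 2 := by
    rw [← integral_indicator (measurableSet_nearPairs N)]
    refine integral_mono (i12.sub (i3.const_mul 2)) ?_ fun p => ?_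
    · rw [integrable_indicator_iff (measurableSet_nearPairs N)]
      exact hu.memLp_diffQuot.integrable_sq
    · by_cases hp : ‖p.1 - p.2‖ ∈ Set.Icc h 1
      · have hn : p ∈ nearPairs N := hp.2
        simp only [annulusKernel, Set.indicator_of_mem hp, Set.indicator_of_mem hn, diffQuot_sq]
        apply le_of_eq
        ring
      · simp only [annulusKernel, Set.indicator_of_notMem hp, mul_zero, add_zero, sub_zero]
        exact Set.indicator_nonneg (fun _ _ => sq_nonneg _) _
  rw [integral_sub i12 (i3.const_mul 2), integral_add i1 i2, integral_const_mul, e1, e2,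
    hkI] at hle
  rw [energy_self]
  have h2 := mul_le_mul_of_nonneg_left hle (by positivity : 0 ≤ cConst N / 2)
  refine le_trans (le_of_eq ?_) h2
  linear_combination (-Real.log (1 / h) * ∫ x, u x ^ 2) * hcV

/-- A Hilbert–Schmidt bound for the trace of the operator with kernel `annulusKernel` on an
orthonormal family. -/
theorem sum_integral_annulusKernel_le (hA : Admissible Ω) (hh : 0 < h) (h1 : h ≤ 1) {m : ℕ}
    (φ : Fin m → memHSubmodule Ω) (hφ : Orthonormal ℝ fun i => toL2 hA (φ i)) :
    ∑ i, (∫ p : EuclideanSpace ℝ (Fin N) × EuclideanSpace ℝ (Fin N),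
      (φ i).1 p.1 * (φ i).1 p.2 * annulusKernel N h (p.1 - p.2)) ≤
      m / 2 + volume.real Ω * (unitBallVolume N * (1 / h) ^ N) / 2 := by
  obtain ⟨hk, hkI⟩ := integral_annulusKernel_sq hA.1 hh h1
  have hone : Integrable (Ω.indicator (1 : EuclideanSpace ℝ (Fin N) → ℝ)) := by
    rw [integrable_indicator_iff hA.2]
    exact integrableOn_const hA.volume_lt_top.ne
  obtain ⟨i1, e1⟩ := integrable_mul_comp_sub hone hk
    (fun z => by rw [annulusKernel_neg])
  rw [← Measure.volume_eq_prod] at i1 e1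
  have i2 (i : Fin m) := (φ i).2.integrable_mul_annulusKernel hA (φ i).2 hh h1
  have i3 (i j : Fin m) : Integrable
      (fun p : EuclideanSpace ℝ (Fin N) × EuclideanSpace ℝ (Fin N) =>
      ((φ i).1 p.1 * (φ j).1 p.1) * ((φ i).1 p.2 * (φ j).1 p.2)) volume :=
    ((φ i).2.integrable_mul hA (φ j).2).mul_prod ((φ i).2.integrable_mul hA (φ j).2)
  have e3 (i j : Fin m) : ∫ p : EuclideanSpace ℝ (Fin N) × EuclideanSpace ℝ (Fin N),
      ((φ i).1 p.1 * (φ j).1 p.1) * ((φ i).1 p.2 * (φ j).1 p.2) = if i = j then 1 else 0 := by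
    rw [Measure.volume_eq_prod, integral_prod_mul (fun x => (φ i).1 x * (φ j).1 x)
      (fun x => (φ i).1 x * (φ j).1 x), ← inner_toL2 hA, orthonormal_iff_ite.mp hφ]
    split_ifs <;> simp
  have hI1 : Integrable (fun p : EuclideanSpace ℝ (Fin N) × EuclideanSpace ℝ (Fin N) =>
      ∑ i, (φ i).1 p.1 * (φ i).1 p.2 * annulusKernel N h (p.1 - p.2)) volume :=
    integrable_finsetSum _ fun i _ => i2 i
  have hI2 : Integrable (fun p : EuclideanSpace ℝ (Fin N) × EuclideanSpace ℝ (Fin N) =>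
      ∑ i, ∑ j, ((φ i).1 p.1 * (φ j).1 p.1) * ((φ i).1 p.2 * (φ j).1 p.2)) volume :=
    integrable_finsetSum _ fun i _ => integrable_finsetSum _ fun j _ => i3 i j
  have i4 : Integrable (fun p : EuclideanSpace ℝ (Fin N) × EuclideanSpace ℝ (Fin N) =>
      Ω.indicator 1 p.1 * annulusKernel N h (p.1 - p.2) ^ 2
        - 2 * (∑ i, (φ i).1 p.1 * (φ i).1 p.2 * annulusKernel N h (p.1 - p.2))) volume :=
    i1.sub (hI1.const_mul 2)
  -- This is the integral over `Ω × ℝ^N` of the square of `k_h(x-y) - ∑ φ_i(x) φ_i(y)`. The square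
  -- of the projection kernel integrates to `m` by orthonormality.
  have hnn : 0 ≤ ∫ p : EuclideanSpace ℝ (Fin N) × EuclideanSpace ℝ (Fin N),
      (Ω.indicator 1 p.1 * annulusKernel N h (p.1 - p.2) ^ 2
        - 2 * (∑ i, (φ i).1 p.1 * (φ i).1 p.2 * annulusKernel N h (p.1 - p.2))
        + ∑ i, ∑ j, ((φ i).1 p.1 * (φ j).1 p.1) * ((φ i).1 p.2 * (φ j).1 p.2)) := by
    refine integral_nonneg fun p => ?_
    have hsq : ∑ i, ∑ j, ((φ i).1 p.1 * (φ j).1 p.1) * ((φ i).1 p.2 * (φ j).1 p.2) =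
        (∑ i, (φ i).1 p.1 * (φ i).1 p.2) ^ 2 := by
      rw [sq, Finset.sum_mul_sum]
      exact Finset.sum_congr rfl fun i _ => Finset.sum_congr rfl fun j _ => by ring
    simp only [Pi.zero_apply]
    rw [hsq, ← Finset.sum_mul]
    by_cases hp : p.1 ∈ Ω
    · simp only [Set.indicator_of_mem hp, Pi.one_apply]
      nlinarith [sq_nonneg (annulusKernel N h (p.1 - p.2) - ∑ i, (φ i).1 p.1 * (φ i).1 p.2)]
    · have h0 : ∀ i, (φ i).1 p.1 = 0 := fun i => (φ i).2.2 _ hp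
      simp [hp, h0]
  rw [integral_add i4 hI2, integral_sub i1 (hI1.const_mul 2), e1,
    integral_const_mul, integral_finsetSum _ (fun i _ => i2 i),
    integral_finsetSum _ (fun i _ => integrable_finsetSum _ fun j _ => i3 i j),
    integral_indicator_one hA.2] at hnn
  have e4 : ∑ i : Fin m, ∫ p : EuclideanSpace ℝ (Fin N) × EuclideanSpace ℝ (Fin N),
      ∑ j, ((φ i).1 p.1 * (φ j).1 p.1) * ((φ i).1 p.2 * (φ j).1 p.2) = m := by
    simp only [integral_finsetSum _ (fun j _ => i3 _ j), e3]
    simp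
  rw [e4] at hnn
  have := mul_le_mul_of_nonneg_left hkI (measureReal_nonneg (μ := volume) (s := Ω))
  linarith

/-- An upper bound for the number of orthonormal functions with logarithmic energy at most `t`. -/
theorem exists_card_le (hA : Admissible Ω) : ∃ C : ℝ, 0 < C ∧ ∀ (t : ℝ) (m : ℕ)
    (φ : Fin m → memHSubmodule Ω), Orthonormal ℝ (fun i => toL2 hA (φ i)) →
    (∀ i, logEnergy (φ i).1 (φ i).1 ≤ t) → (m : ℝ) ≤ C * Real.exp (N / 2 * max t 0) := by
  have hc := cConst_pos hA.1
  have hs := shift_pos hA.1 (Ω := Ω)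
  have hV := unitBallVolume_pos hA.1
  -- `shift Ω` absorbs the bounded part of the form and `cConst N / 2` the term `m/2` of the trace
  -- bound. The `1` in `s + shift Ω - 1` then leaves exactly `m` on the left.
  set B : ℝ := shift Ω + cConst N / 2 with hB
  have hB0 : 0 < B := by positivity
  refine ⟨cConst N * (volume.real Ω * unitBallVolume N) / 2 * Real.exp (N / 2 * B) + 1,
    by positivity, fun t m φ hφ ht => ?_⟩
  set s := max t 0 with hsdef
  have hs0 : 0 ≤ s := le_max_right _ _
  set h := Real.exp (-((s + B) / 2)) with hh
  have hh0 : 0 < h := Real.exp_pos _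
  have hh1 : h ≤ 1 := Real.exp_le_one_iff.mpr (by linarith)
  have hinv : 1 / h = Real.exp ((s + B) / 2) := by rw [hh, Real.exp_neg, one_div, inv_inv]
  have hlog : 2 * Real.log (1 / h) = s + B := by rw [hinv, Real.log_exp]; ring
  have hpow : (1 / h) ^ N = Real.exp (N / 2 * s) * Real.exp (N / 2 * B) := by
    rw [hinv, ← Real.exp_nat_mul, ← Real.exp_add]
    congr 1
    ring
  have hterm : ∀ i, 2 * Real.log (1 / h) - cConst N *
      (∫ p : EuclideanSpace ℝ (Fin N) × EuclideanSpace ℝ (Fin N),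
        (φ i).1 p.1 * (φ i).1 p.2 * annulusKernel N h (p.1 - p.2)) ≤ s + shift Ω - 1 := by
    intro i
    have h2 := (φ i).2.le_energy hA hh0 hh1
    have h3 := (abs_le.mp ((φ i).2.abs_logEnergy_sub_energy_le hA)).1
    have h4 : ∫ x, (φ i).1 x ^ 2 = 1 := by
      rw [← norm_toL2_sq hA, hφ.1 i, one_pow]
    rw [h4] at h2 h3
    have h5 := (ht i).trans (le_max_left t 0)
    linarith
  simp only [hlog] at hterm
  have hsum := Finset.sum_le_sum fun i (_ : i ∈ Finset.univ) => hterm i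
  rw [Finset.sum_sub_distrib, ← Finset.mul_sum] at hsum
  simp only [Finset.sum_const, Finset.card_univ, Fintype.card_fin, nsmul_eq_mul] at hsum
  have htr := mul_le_mul_of_nonneg_left (sum_integral_annulusKernel_le hA hh0 hh1 φ hφ) hc.le
  rw [hpow] at htr
  have hexp : 0 < Real.exp (N / 2 * s) := Real.exp_pos _
  have : (m : ℝ) ≤ cConst N * (volume.real Ω * (unitBallVolume N *
      (Real.exp (N / 2 * s) * Real.exp (N / 2 * B))) / 2) := by
    rw [hB] at hsum htr ⊢
    nlinarith
  nlinarith

end Count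

/-! ### Energy of Lipschitz functions, density and tents -/

section Trial

variable {N : ℕ} {Ω S : Set (EuclideanSpace ℝ (Fin N))}
  {u v w : EuclideanSpace ℝ (Fin N) → ℝ} {h K : ℝ}

theorem sq_sub_le_indicator (hK : ∀ x y, |u x - u y| ≤ K * ‖x - y‖)
    (hS : ∀ x, x ∉ S → u x = 0) (p : EuclideanSpace ℝ (Fin N) × EuclideanSpace ℝ (Fin N)) :
    (u p.1 - u p.2) ^ 2 ≤ K ^ 2 * ‖p.1 - p.2‖ ^ 2 * (S.indicator 1 p.1 + S.indicator 1 p.2) := by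
  have h1 : (u p.1 - u p.2) ^ 2 ≤ K ^ 2 * ‖p.1 - p.2‖ ^ 2 := by
    rw [← mul_pow, ← sq_abs]
    exact pow_le_pow_left₀ (abs_nonneg _) (hK _ _) 2
  have h0 : 0 ≤ K ^ 2 * ‖p.1 - p.2‖ ^ 2 := by positivity
  by_cases hp1 : p.1 ∈ S <;> by_cases hp2 : p.2 ∈ S
  · simp only [Set.indicator_of_mem hp1, Set.indicator_of_mem hp2, Pi.one_apply]
    linarith
  · simpa [hp1, hp2] using h1
  · simpa [hp1, hp2] using h1
  · simp [hS _ hp1, hS _ hp2, hp1, hp2]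

theorem sq_sub_div_le_coreKernel (hK : ∀ x y, |u x - u y| ≤ K * ‖x - y‖)
    (hS : ∀ x, x ∉ S → u x = 0) {p : EuclideanSpace ℝ (Fin N) × EuclideanSpace ℝ (Fin N)}
    (hp : ‖p.1 - p.2‖ ≤ h) : (u p.1 - u p.2) ^ 2 / ‖p.1 - p.2‖ ^ N ≤
      K ^ 2 * (S.indicator 1 p.1 * coreKernel N h (p.1 - p.2)
        + S.indicator 1 p.2 * coreKernel N h (p.1 - p.2)) := by
  have hmem : ‖p.1 - p.2‖ ∈ Set.Icc 0 h := ⟨norm_nonneg _, hp⟩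
  rw [coreKernel, Set.indicator_of_mem hmem]
  refine (div_le_div_of_nonneg_right (sq_sub_le_indicator hK hS p) (by positivity)).trans
    (le_of_eq ?_)
  ring

theorem integrable_indicator_mul_coreKernel (hN : 1 ≤ N) (hSm : MeasurableSet S)
    (hSv : volume S < ⊤) (hh : 0 ≤ h) :
    Integrable (fun p : EuclideanSpace ℝ (Fin N) × EuclideanSpace ℝ (Fin N) =>
      K ^ 2 * (S.indicator 1 p.1 * coreKernel N h (p.1 - p.2)
        + S.indicator 1 p.2 * coreKernel N h (p.1 - p.2))) volume ∧
    ∫ p : EuclideanSpace ℝ (Fin N) × EuclideanSpace ℝ (Fin N),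
      K ^ 2 * (S.indicator 1 p.1 * coreKernel N h (p.1 - p.2)
        + S.indicator 1 p.2 * coreKernel N h (p.1 - p.2)) =
      K ^ 2 * h ^ 2 * volume.real S * (N * unitBallVolume N) := by
  obtain ⟨hk, hkI⟩ := integral_coreKernel hN hh
  have hone : Integrable (S.indicator (1 : EuclideanSpace ℝ (Fin N) → ℝ)) := by
    rw [integrable_indicator_iff hSm]
    exact integrableOn_const hSv.ne
  obtain ⟨i1, e1⟩ := integrable_mul_comp_sub hone hk coreKernel_neg
  obtain ⟨i2, e2⟩ := integrable_mul_comp_sub' hone hk coreKernel_neg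
  rw [← Measure.volume_eq_prod] at i1 e1 i2 e2
  refine ⟨(i1.add i2).const_mul _, ?_⟩
  rw [integral_const_mul, integral_add i1 i2, e1, e2, hkI, integral_indicator_one hSm]
  ring

/-- Lipschitz functions vanishing outside `Ω` belong to `ℍ(Ω)`. -/
theorem memH_of_lipschitz (hA : Admissible Ω) (hK : ∀ x y, |u x - u y| ≤ K * ‖x - y‖)
    (hΩ : ∀ x, x ∉ Ω → u x = 0) : MemH Ω u := by
  have hK0 : LipschitzWith K.toNNReal u := LipschitzWith.of_dist_le_mul fun x y => by
    rw [dist_eq_norm, dist_eq_norm, Real.norm_eq_abs]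
    exact (hK x y).trans (mul_le_mul_of_nonneg_right (Real.le_coe_toNNReal K) (norm_nonneg _))
  have hm : AEMeasurable u volume := hK0.continuous.measurable.aemeasurable
  refine ⟨hm, hΩ, ?_⟩
  have hi := (integrable_indicator_mul_coreKernel (K := K) hA.1 hA.2 hA.volume_lt_top
    zero_le_one).1
  refine (hi.integrableOn (s := nearPairs N)).mono' ?_ ?_
  · exact ((((aemeasurable_fst hm).sub (aemeasurable_snd hm)).pow_const 2).div
      (Measurable.aemeasurable (by fun_prop))).aestronglyMeasurable.restrict
  · filter_upwards [ae_restrict_mem (measurableSet_nearPairs N)] with p hp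
    rw [Real.norm_of_nonneg (by positivity)]
    exact sq_sub_div_le_coreKernel hK hΩ hp

/-- The energy of a nonnegative Lipschitz function. -/
theorem energy_le_of_lipschitz (hA : Admissible Ω) (hK : ∀ x y, |u x - u y| ≤ K * ‖x - y‖)
    (hΩ : ∀ x, x ∉ Ω → u x = 0) (hSm : MeasurableSet S) (hSv : volume S < ⊤)
    (hS : ∀ x, x ∉ S → u x = 0) (hu : ∀ x, 0 ≤ u x) (hh : 0 < h) (h1 : h ≤ 1) :
    energy u u ≤ K ^ 2 * h ^ 2 * volume.real S + 2 * Real.log (1 / h) * ∫ x, u x ^ 2 := by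
  have huH := memH_of_lipschitz hA hK hΩ
  obtain ⟨ic, ec⟩ := integrable_indicator_mul_coreKernel (K := K) hA.1 hSm hSv hh.le
  obtain ⟨hk, hkI⟩ := integral_annulusKernel hA.1 hh h1
  obtain ⟨i1, e1⟩ := integrable_mul_comp_sub (huH.integrable_sq hA) hk annulusKernel_neg
  obtain ⟨i2, e2⟩ := integrable_mul_comp_sub' (huH.integrable_sq hA) hk annulusKernel_neg
  rw [← Measure.volume_eq_prod] at i1 e1 i2 e2
  have i12 : Integrable (fun p : EuclideanSpace ℝ (Fin N) × EuclideanSpace ℝ (Fin N) =>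
      u p.1 ^ 2 * annulusKernel N h (p.1 - p.2) + u p.2 ^ 2 * annulusKernel N h (p.1 - p.2))
      volume := i1.add i2
  have hc := cConst_pos hA.1
  have hcV := cConst_mul_unitBallVolume hA.1
  have hle : ∫ p in nearPairs N, diffQuot u p ^ 2 ≤
      ∫ p : EuclideanSpace ℝ (Fin N) × EuclideanSpace ℝ (Fin N),
      (K ^ 2 * (S.indicator 1 p.1 * coreKernel N h (p.1 - p.2)
        + S.indicator 1 p.2 * coreKernel N h (p.1 - p.2)) +
      (u p.1 ^ 2 * annulusKernel N h (p.1 - p.2)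
        + u p.2 ^ 2 * annulusKernel N h (p.1 - p.2))) := by
    rw [← integral_indicator (measurableSet_nearPairs N)]
    refine integral_mono ?_ (ic.add i12) fun p => ?_
    · rw [integrable_indicator_iff (measurableSet_nearPairs N)]
      exact huH.memLp_diffQuot.integrable_sq
    · have hc0 : 0 ≤ K ^ 2 * (S.indicator 1 p.1 * coreKernel N h (p.1 - p.2)
          + S.indicator 1 p.2 * coreKernel N h (p.1 - p.2)) := by
        have a1 := coreKernel_nonneg (h := h) (p.1 - p.2)
        have a2 : (0 : ℝ) ≤ S.indicator 1 p.1 :=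
          Set.indicator_nonneg (fun _ _ => zero_le_one) _
        have a3 : (0 : ℝ) ≤ S.indicator 1 p.2 :=
          Set.indicator_nonneg (fun _ _ => zero_le_one) _
        positivity
      have ha0 := annulusKernel_nonneg hh (p.1 - p.2)
      have hb0 : 0 ≤ u p.1 ^ 2 * annulusKernel N h (p.1 - p.2)
        + u p.2 ^ 2 * annulusKernel N h (p.1 - p.2) := by positivity
      by_cases hp : p ∈ nearPairs N
      · rw [Set.indicator_of_mem hp, diffQuot_sq]
        rcases le_total ‖p.1 - p.2‖ h with hph | hph
        · have := sq_sub_div_le_coreKernel hK hS hph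
          linarith
        -- Away from the diagonal, `u ≥ 0` gives `(u(x)-u(y))² ≤ u(x)² + u(y)²`: the cross term has
        -- the favourable sign.
        · have hmem : ‖p.1 - p.2‖ ∈ Set.Icc h 1 := ⟨hph, hp⟩
          refine le_trans ?_ (le_add_of_nonneg_left hc0)
          rw [annulusKernel, Set.indicator_of_mem hmem, ← add_mul, mul_one_div]
          refine div_le_div_of_nonneg_right ?_ (by positivity)
          nlinarith [mul_nonneg (hu p.1) (hu p.2)]
      · rw [Set.indicator_of_notMem hp]
        positivity
  rw [integral_add ic i12, ec, integral_add i1 i2, e1, e2, hkI] at hle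
  rw [energy_self]
  refine (mul_le_mul_of_nonneg_left hle (by positivity : 0 ≤ cConst N / 2)).trans (le_of_eq ?_)
  linear_combination (K ^ 2 * h ^ 2 * volume.real S / 2
    + Real.log (1 / h) * ∫ x, u x ^ 2) * hcV

/-- `ℍ(Ω)` is dense in `L²(Ω)`. -/
theorem denseRange_toL2 (hA : Admissible Ω) (hΩ : IsOpen Ω) : DenseRange (toL2 hA) := by
  have htop : (LinearMap.range (toL2 hA)).topologicalClosure = ⊤ := by
    rw [Submodule.topologicalClosure_eq_top_iff, Submodule.eq_bot_iff]
    intro f hf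
    have hfi : IntegrableOn f Ω := by
      have : IsFiniteMeasure (volume.restrict Ω) := ⟨by simpa using hA.volume_lt_top⟩
      exact (Lp.memLp f).integrable one_le_two
    -- Test functions supported in `Ω` are Lipschitz, hence in `ℍ(Ω)`; an `f` orthogonal to all of
    -- them vanishes almost everywhere.
    have h0 := hΩ.ae_eq_zero_of_integral_contDiff_smul_eq_zero (f := f) (μ := volume)
      hfi.locallyIntegrableOn ?_
    · rw [Lp.eq_zero_iff_ae_eq_zero]
      exact (ae_restrict_iff' hA.2).mpr h0
    · intro g hg hgc hgs
      obtain ⟨C, hC⟩ := (hg.of_le (by simp) : ContDiff ℝ 1 g).lipschitzWith_of_hasCompactSupport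
        hgc one_ne_zero
      have hgΩ : ∀ x, x ∉ Ω → g x = 0 := fun x hx =>
        image_eq_zero_of_notMem_tsupport fun h => hx (hgs h)
      have hgH : MemH Ω g := memH_of_lipschitz hA (K := C) (fun x y => by
        simpa [Real.dist_eq, dist_eq_norm] using hC.dist_le_mul x y) hgΩ
      have h1 : inner ℝ (toL2 hA ⟨g, hgH⟩) f = 0 := hf _ ⟨⟨g, hgH⟩, rfl⟩
      rw [L2.inner_def] at h1
      have h2 : ∫ x in Ω, g x • f x = ∫ x, g x • f x :=
        setIntegral_eq_integral_of_forall_compl_eq_zero fun x hx => by simp [hgΩ x hx]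
      rw [← h2, ← h1]
      refine integral_congr_ae ?_
      filter_upwards [coeFn_toL2 hA ⟨g, hgH⟩] with x hx
      rw [hx]
      exact mul_comm _ _
  exact Submodule.dense_iff_topologicalClosure_eq_top.mpr htop

/-- The tent function of radius `h` around `a`. -/
def tent (a : EuclideanSpace ℝ (Fin N)) (h : ℝ) (x : EuclideanSpace ℝ (Fin N)) : ℝ :=
  max 0 (1 - ‖x - a‖ / h)

theorem tent_nonneg (a : EuclideanSpace ℝ (Fin N)) (h : ℝ) (x : EuclideanSpace ℝ (Fin N)) :
    0 ≤ tent a h x := le_max_left _ _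

theorem tent_eq_zero {a x : EuclideanSpace ℝ (Fin N)} (hh : 0 < h) (hx : h ≤ ‖x - a‖) :
    tent a h x = 0 := by
  refine max_eq_left ?_
  rw [sub_nonpos, le_div_iff₀ hh]
  linarith

theorem tent_lipschitz (a : EuclideanSpace ℝ (Fin N)) (hh : 0 < h)
    (x y : EuclideanSpace ℝ (Fin N)) : |tent a h x - tent a h y| ≤ 1 / h * ‖x - y‖ := by
  unfold tent
  rw [max_comm 0, max_comm 0]
  refine (abs_max_sub_max_le_abs _ _ _).trans ?_
  rw [show 1 - ‖x - a‖ / h - (1 - ‖y - a‖ / h) = -((‖x - a‖ - ‖y - a‖) / h) by ring, abs_neg,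
    abs_div, abs_of_pos hh, div_eq_mul_one_div, mul_comm]
  refine mul_le_mul_of_nonneg_left ((abs_norm_sub_norm_le _ _).trans (le_of_eq ?_)) (by positivity)
  congr 1
  abel

/-- The tent is at least `1/2` on the ball of half the radius: `2^N` comes from the volumes and `4`
from the square. -/
theorem volume_ball_le_integral_tent_sq (hA : Admissible Ω) (hh : 0 < h)
    {a : EuclideanSpace ℝ (Fin N)} (ht : MemH Ω (tent a h)) :
    volume.real (Metric.ball a h) ≤ 2 ^ (N + 2) * ∫ x, tent a h x ^ 2 := by
  have : Nonempty (Fin N) := ⟨⟨0, hA.1⟩⟩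
  have h1 : volume.real (Metric.ball a h) = 2 ^ N * volume.real (Metric.ball a (h / 2)) := by
    rw [Measure.real, Measure.real, Measure.addHaar_ball _ _ hh.le,
      Measure.addHaar_ball _ _ (by positivity : 0 ≤ h / 2), finrank_euclideanSpace_fin,
      ENNReal.toReal_mul, ENNReal.toReal_mul, ENNReal.toReal_ofReal (by positivity),
      ENNReal.toReal_ofReal (by positivity), div_pow]
    field_simp
  have h2 : ∫ x, (Metric.ball a (h / 2)).indicator (fun _ => (1 / 4 : ℝ)) x ≤
      ∫ x, tent a h x ^ 2 := by
    refine integral_mono ?_ (ht.integrable_sq hA) fun x => ?_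
    · rw [integrable_indicator_iff measurableSet_ball]
      exact integrableOn_const measure_ball_lt_top.ne
    · by_cases hx : x ∈ Metric.ball a (h / 2)
      · rw [Set.indicator_of_mem hx]
        rw [Metric.mem_ball, dist_eq_norm] at hx
        have h3 : 1 / 2 ≤ tent a h x := by
          refine le_trans ?_ (le_max_right _ _)
          have : ‖x - a‖ / h ≤ 1 / 2 := by
            rw [div_le_iff₀ hh]
            linarith
          linarith
        nlinarith
      · rw [Set.indicator_of_notMem hx]
        positivity
  rw [integral_indicator measurableSet_ball, setIntegral_const, smul_eq_mul] at h2
  rw [h1, pow_add]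
  nlinarith [pow_pos (two_pos : (0 : ℝ) < 2) N]

end Trial

/-! ### Orthonormal tents on a lattice and existence of the eigensystem -/

section Family

variable {N : ℕ} {Ω : Set (EuclideanSpace ℝ (Fin N))}

/-- The point of the integer lattice with coordinates `k`. -/
def latticePoint {m : ℕ} (k : Fin N → Fin m) : EuclideanSpace ℝ (Fin N) :=
  WithLp.toLp 2 fun i => ((k i : ℕ) : ℝ)

theorem norm_latticePoint_le {m : ℕ} (k : Fin N → Fin m) : ‖latticePoint k‖ ≤ N * m := by
  rw [EuclideanSpace.norm_eq]
  refine Real.sqrt_le_iff.mpr ⟨by positivity, ?_⟩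
  calc ∑ i, ‖latticePoint k i‖ ^ 2 ≤ ∑ _i : Fin N, (m : ℝ) ^ 2 := by
        refine Finset.sum_le_sum fun i _ => ?_
        have : ((k i : ℕ) : ℝ) ≤ m := by exact_mod_cast (k i).2.le
        simpa [latticePoint] using pow_le_pow_left₀ (by positivity) this 2
    _ = N * (m : ℝ) ^ 2 := by simp
    _ ≤ (N * m) ^ 2 := by
        rw [mul_pow]
        refine mul_le_mul_of_nonneg_right ?_ (by positivity)
        exact_mod_cast Nat.le_self_pow two_ne_zero N

theorem one_le_norm_latticePoint_sub {m : ℕ} {k l : Fin N → Fin m} (hkl : k ≠ l) :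
    1 ≤ ‖latticePoint k - latticePoint l‖ := by
  obtain ⟨i, hi⟩ := Function.ne_iff.mp hkl
  refine le_trans ?_ (PiLp.norm_apply_le (latticePoint k - latticePoint l) i)
  have hne : ((k i : ℕ) : ℤ) - ((l i : ℕ) : ℤ) ≠ 0 := by
    intro h
    apply hi
    ext
    omega
  have h1 := Int.one_le_abs hne
  have : (1 : ℝ) ≤ |((k i : ℕ) : ℝ) - ((l i : ℕ) : ℝ)| := by exact_mod_cast h1
  simpa [latticePoint] using this

/-- Orthonormal families of `m ^ N` functions in `ℍ(Ω)` with logarithmic energy at most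
`2 log m + C`. -/
theorem exists_orthonormal_logEnergy_le (hA : Admissible Ω) (hΩ : IsOpen Ω) (hne : Ω.Nonempty) :
    ∃ C : ℝ, ∀ m : ℕ, 1 ≤ m → ∃ φ : (Fin N → Fin m) → memHSubmodule Ω,
      Orthonormal ℝ (fun k => toL2 hA (φ k)) ∧
      ∀ k, logEnergy (φ k).1 (φ k).1 ≤ 2 * Real.log m + C := by
  have : Nonempty (Fin N) := ⟨⟨0, hA.1⟩⟩
  have hN : (1 : ℝ) ≤ N := by exact_mod_cast hA.1
  obtain ⟨x₀, hx₀⟩ := hne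
  obtain ⟨r, hr, hball⟩ := Metric.isOpen_iff.mp hΩ x₀ hx₀
  -- Tents of radius `h = δ/m` centred at `x₀ + 2h k` stay within `δ + 2Nδ ≤ 4Nδ ≤ r` of `x₀`;
  -- spacing `2h` makes them disjoint.
  set δ : ℝ := min 1 (r / (4 * N)) with hδ
  have hδ0 : 0 < δ := lt_min one_pos (by positivity)
  have hδ1 : δ ≤ 1 := min_le_left _ _
  have hδr : δ * (4 * N) ≤ r := by
    have := min_le_right 1 (r / (4 * N))
    rwa [← hδ, le_div_iff₀ (by positivity)] at this
  -- The three terms come from `log(1/h) = log m + log(1/δ)`, from the Lipschitz core, where `K h =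
  -- 1` leaves only the volume of the ball, and from the bounded part of the form.
  refine ⟨2 * Real.log (1 / δ) + 2 ^ (N + 2) + shift Ω, fun m hm => ?_⟩
  have hm' : (1 : ℝ) ≤ m := by exact_mod_cast hm
  set h : ℝ := δ / m with hh
  have hh0 : 0 < h := by positivity
  have hhm : h * m = δ := div_mul_cancel₀ _ (by positivity)
  have hhδ : h ≤ δ := div_le_self hδ0.le hm'
  have hh1 : h ≤ 1 := hhδ.trans hδ1
  let a : (Fin N → Fin m) → EuclideanSpace ℝ (Fin N) := fun k => x₀ + (2 * h) • latticePoint k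
  have hsub : ∀ k x, x ∉ Ω → tent (a k) h x = 0 := by
    intro k x hx
    refine tent_eq_zero hh0 ?_
    by_contra! hlt
    refine hx (hball ?_)
    rw [Metric.mem_ball, dist_eq_norm]
    have h1 : x - x₀ = (x - a k) + (2 * h) • latticePoint k := by simp only [a]; abel
    have h2 : ‖(2 * h) • latticePoint k‖ ≤ 2 * δ * N := by
      rw [norm_smul, Real.norm_of_nonneg (by positivity)]
      calc 2 * h * ‖latticePoint k‖ ≤ 2 * h * (N * m) :=
            mul_le_mul_of_nonneg_left (norm_latticePoint_le k) (by positivity)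
        _ = 2 * δ * N := by rw [← hhm]; ring
    rw [h1]
    have h3 := norm_add_le (x - a k) ((2 * h) • latticePoint k)
    nlinarith
  have hT : ∀ k, MemH Ω (tent (a k) h) := fun k =>
    memH_of_lipschitz hA (tent_lipschitz (a k) hh0) (hsub k)
  have hdisj : ∀ k l, k ≠ l → ∀ x, tent (a k) h x * tent (a l) h x = 0 := by
    intro k l hkl x
    rcases le_or_gt h ‖x - a k‖ with hk | hk
    · rw [tent_eq_zero hh0 hk, zero_mul]
    rcases le_or_gt h ‖x - a l‖ with hl | hl
    · rw [tent_eq_zero hh0 hl, mul_zero]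
    exfalso
    have h1 : (2 * h) • (latticePoint k - latticePoint l) = (x - a l) - (x - a k) := by
      simp only [a, smul_sub]
      abel
    have h2 : 2 * h ≤ ‖(x - a l) - (x - a k)‖ := by
      rw [← h1, norm_smul, Real.norm_of_nonneg (by positivity)]
      exact le_mul_of_one_le_right (by positivity) (one_le_norm_latticePoint_sub hkl)
    have h3 := norm_sub_le (x - a l) (x - a k)
    linarith
  let A : (Fin N → Fin m) → ℝ := fun k => ∫ x, tent (a k) h x ^ 2
  have hvol : ∀ k, volume.real (Metric.ball (a k) h) ≤ 2 ^ (N + 2) * A k := fun k =>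
    volume_ball_le_integral_tent_sq hA hh0 (hT k)
  have hA0 : ∀ k, 0 < A k := fun k => by
    have h1 : 0 < volume.real (Metric.ball (a k) h) :=
      ENNReal.toReal_pos (Metric.measure_ball_pos _ _ hh0).ne' measure_ball_lt_top.ne
    exact pos_of_mul_pos_right (h1.trans_le (hvol k)) (by positivity)
  have hsq : ∀ k, (√(A k))⁻¹ * ((√(A k))⁻¹ * A k) = 1 := fun k => by
    have h1 : √(A k) ≠ 0 := (Real.sqrt_pos.mpr (hA0 k)).ne'
    have h2 := Real.mul_self_sqrt (hA0 k).le
    field_simp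
    rw [sq, h2]
  refine ⟨fun k => (√(A k))⁻¹ • ⟨tent (a k) h, hT k⟩, ?_, fun k => ?_⟩
  · rw [orthonormal_iff_ite]
    intro k l
    rw [map_smul, map_smul, real_inner_smul_left, real_inner_smul_right, inner_toL2]
    split_ifs with hkl
    · subst hkl
      simp only [← sq]
      exact hsq k
    · simp [hdisj k l hkl]
  · change logEnergy ((√(A k))⁻¹ • tent (a k) h) ((√(A k))⁻¹ • tent (a k) h) ≤ _
    rw [logEnergy_smul_left, logEnergy_symm, logEnergy_smul_left]
    have h1 := energy_le_of_lipschitz hA (tent_lipschitz (a k) hh0) (hsub k)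
      (measurableSet_ball (x := a k) (ε := h)) measure_ball_lt_top
      (fun x hx => tent_eq_zero hh0 (by
        rw [Metric.mem_ball, dist_eq_norm, not_lt] at hx
        exact hx)) (tent_nonneg _ _) hh0 hh1
    have h2 := (abs_le.mp ((hT k).abs_logEnergy_sub_energy_le hA)).2
    have h3 : (1 / h) ^ 2 * h ^ 2 = 1 := by field_simp
    have h4 : Real.log (1 / h) = Real.log m + Real.log (1 / δ) := by
      rw [← Real.log_mul (by positivity) (by positivity), hh]
      congr 1
      field_simp
    rw [h3, one_mul, h4] at h1
    have h5 : logEnergy (tent (a k) h) (tent (a k) h) ≤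
        (2 * Real.log m + (2 * Real.log (1 / δ) + 2 ^ (N + 2) + shift Ω)) * A k := by
      have h6 := hvol k
      have h7 := hA0 k
      change _ ≤ _ + 2 * _ * A k at h1
      change _ ≤ (shift Ω - 1) * A k at h2
      linarith
    have h8 : 0 ≤ (√(A k))⁻¹ := by positivity
    calc (√(A k))⁻¹ * ((√(A k))⁻¹ * logEnergy (tent (a k) h) (tent (a k) h))
        ≤ (√(A k))⁻¹ * ((√(A k))⁻¹ * ((2 * Real.log m +
          (2 * Real.log (1 / δ) + 2 ^ (N + 2) + shift Ω)) * A k)) :=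
          mul_le_mul_of_nonneg_left (mul_le_mul_of_nonneg_left h5 h8) h8
      _ = (2 * Real.log m + (2 * Real.log (1 / δ) + 2 ^ (N + 2) + shift Ω)) *
          ((√(A k))⁻¹ * ((√(A k))⁻¹ * A k)) := by ring
      _ = _ := by rw [hsq k, mul_one]

theorem not_finiteDimensional (hA : Admissible Ω) (hΩ : IsOpen Ω) (hne : Ω.Nonempty) :
    ¬ FiniteDimensional ℝ (Lp ℝ 2 (volume.restrict Ω)) := by
  intro hfd
  obtain ⟨C, hC⟩ := exists_orthonormal_logEnergy_le hA hΩ hne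
  set d := Module.finrank ℝ (Lp ℝ 2 (volume.restrict Ω))
  obtain ⟨φ, hφ, -⟩ := hC (d + 1) (by omega)
  have h1 := hφ.linearIndependent.fintype_card_le_finrank
  rw [Fintype.card_fun, Fintype.card_fin, Fintype.card_fin] at h1
  have h2 := Nat.le_self_pow (Nat.one_le_iff_ne_zero.mp hA.1) (d + 1)
  omega

/-- Existence of the Dirichlet eigensystem. -/
theorem exists_isEigenSystem (hA : Admissible Ω) (hΩ : IsOpen Ω) (hne : Ω.Nonempty) :
    ∃ (lam : ℕ → ℝ) (phi : ℕ → EuclideanSpace ℝ (Fin N) → ℝ), IsEigenSystem Ω lam phi := by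
  obtain ⟨C, -, hcount⟩ := exists_card_le hA
  obtain ⟨lam, u, b, hmono, hb⟩ := exists_hilbertBasis_of_form
    (fun u w : memHSubmodule Ω => shiftedForm Ω u.1 w.1)
    (fun u w => shiftedForm_symm _ _)
    (fun u v w => shiftedForm_add_left hA u.2 v.2 w.2)
    (fun r u w => shiftedForm_smul_left r) (toL2 hA)
    (fun u => by
      have h1 := u.2.le_shiftedForm hA
      have h2 := energy_self_nonneg hA.1 u.1
      rw [norm_toL2_sq]
      linarith)
    (denseRange_toL2 hA hΩ) (exists_limit_of_shiftedForm_cauchy hA)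
    (fun t => by
      obtain ⟨n, hn⟩ := exists_nat_ge (C * Real.exp (N / 2 * max t 0))
      refine ⟨n, fun m φ hφ ht => ?_⟩
      have h1 := hcount t m φ hφ fun i => by
        have h2 : 0 ≤ ∫ x, (φ i).1 x * (φ i).1 x := integral_nonneg fun _ => mul_self_nonneg _
        have h3 := mul_nonneg (shift_pos hA.1 (Ω := Ω)).le h2
        have h4 : logEnergy (φ i).1 (φ i).1 + shift Ω * ∫ x, (φ i).1 x * (φ i).1 x ≤ t := ht i
        linarith
      exact_mod_cast h1.trans hn)
    (not_finiteDimensional hA hΩ hne)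
  refine ⟨fun i => lam i - shift Ω, fun i => (u i).1, ?_, fun i => ?_, b, fun i => ?_⟩
  · exact fun i j hij => sub_le_sub_right (hmono hij) _
  · refine ⟨(u i).2, fun h0 => ?_, fun w hw => ?_⟩
    · have h1 : ‖b i‖ ^ 2 = 0 := by
        rw [(hb i).1, norm_toL2_sq]
        refine integral_eq_zero_of_ae ?_
        filter_upwards [h0] with x hx
        simp [hx]
      rw [b.orthonormal.1 i] at h1
      norm_num at h1
    · have h1 : shiftedForm Ω (u i).1 w = _ := (hb i).2 ⟨w, hw⟩
      rw [inner_toL2, shiftedForm] at h1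
      rw [(u i).2.setIntegral_mul]
      linarith
  · rw [(hb i).1]
    exact coeFn_toL2 hA (u i)

end Family

/-! ### Counting eigenvalues of an arbitrary eigensystem -/

section Asymptotics

variable {N : ℕ} {Ω : Set (EuclideanSpace ℝ (Fin N))} {lam : ℕ → ℝ}
  {phi : ℕ → EuclideanSpace ℝ (Fin N) → ℝ}

/-- The shifted form as a bilinear map on `ℍ(Ω)`. -/
def shiftedBilin (hA : Admissible Ω) : memHSubmodule Ω →ₗ[ℝ] memHSubmodule Ω →ₗ[ℝ] ℝ :=
  LinearMap.mk₂ ℝ (fun u w => shiftedForm Ω u.1 w.1)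
    (fun u v w => shiftedForm_add_left hA u.2 v.2 w.2)
    (fun r u w => shiftedForm_smul_left r)
    (fun u v w => by
      rw [shiftedForm_symm, shiftedForm_symm u.1 v.1, shiftedForm_symm u.1 w.1]
      exact shiftedForm_add_left hA v.2 w.2 u.2)
    (fun r u w => by
      rw [shiftedForm_symm, shiftedForm_symm u.1 w.1]
      exact shiftedForm_smul_left r)

theorem shiftedBilin_self_nonneg (hA : Admissible Ω) (u : memHSubmodule Ω) :
    0 ≤ shiftedBilin hA u u := by
  have h1 := u.2.le_shiftedForm hA
  have h2 := energy_self_nonneg hA.1 u.1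
  have h3 : 0 ≤ ∫ x, u.1 x ^ 2 := integral_nonneg fun _ => sq_nonneg _
  exact (add_nonneg h2 h3).trans h1

/-- The eigenfunctions of an eigensystem, as elements of `ℍ(Ω)`. -/
def IsEigenSystem.eigenvector (hS : IsEigenSystem Ω lam phi) (i : ℕ) : memHSubmodule Ω :=
  ⟨phi i, (hS.eigen i).memH⟩

theorem IsEigenSystem.exists_basis (hS : IsEigenSystem Ω lam phi) (hA : Admissible Ω) :
    ∃ b : HilbertBasis ℕ ℝ (Lp ℝ 2 (volume.restrict Ω)),
      ∀ i, b i = toL2 hA (hS.eigenvector i) := by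
  obtain ⟨b, hb⟩ := hS.basis
  exact ⟨b, fun i => Lp.ext ((hb i).trans (coeFn_toL2 hA (hS.eigenvector i)).symm)⟩

theorem IsEigenSystem.shiftedBilin_eigenvector (hS : IsEigenSystem Ω lam phi)
    (hA : Admissible Ω) (i : ℕ) (w : memHSubmodule Ω) :
    shiftedBilin hA (hS.eigenvector i) w =
      (lam i + shift Ω) * inner ℝ (toL2 hA (hS.eigenvector i)) (toL2 hA w) := by
  have h := (hS.eigen i).weak_eq w.1 w.2
  rw [(hS.eigen i).memH.setIntegral_mul] at h
  rw [inner_toL2]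
  change logEnergy (phi i) w.1 + shift Ω * ∫ x, phi i x * w.1 x =
    _ * ∫ x, phi i x * w.1 x
  rw [h]
  ring

theorem IsEigenSystem.orthonormal (hS : IsEigenSystem Ω lam phi) (hA : Admissible Ω) :
    Orthonormal ℝ fun i => toL2 hA (hS.eigenvector i) := by
  obtain ⟨b, hb⟩ := hS.exists_basis hA
  simpa only [← hb] using b.orthonormal

theorem IsEigenSystem.add_shift_nonneg (hS : IsEigenSystem Ω lam phi) (hA : Admissible Ω)
    (i : ℕ) : 0 ≤ lam i + shift Ω := by
  have h := shiftedBilin_self_nonneg hA (hS.eigenvector i)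
  rwa [hS.shiftedBilin_eigenvector hA, real_inner_self_eq_norm_sq, (hS.orthonormal hA).1 i,
    one_pow, mul_one] at h

/-- Bessel's inequality for the form: it is nonnegative on `u - s`, where `s` is the partial
expansion of `u` over `G`. -/
theorem IsEigenSystem.sum_le_shiftedBilin (hS : IsEigenSystem Ω lam phi) (hA : Admissible Ω)
    (u : memHSubmodule Ω) (G : Finset ℕ) :
    ∑ j ∈ G, (lam j + shift Ω) * inner ℝ (toL2 hA (hS.eigenvector j)) (toL2 hA u) ^ 2 ≤
      shiftedBilin hA u u := by
  set a : ℕ → ℝ := fun j => inner ℝ (toL2 hA (hS.eigenvector j)) (toL2 hA u) with ha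
  set s : memHSubmodule Ω := ∑ j ∈ G, a j • hS.eigenvector j with hs
  have hsw : ∀ w, shiftedBilin hA s w = ∑ j ∈ G, a j * ((lam j + shift Ω) *
      inner ℝ (toL2 hA (hS.eigenvector j)) (toL2 hA w)) := fun w => by
    simp only [hs, map_sum, map_smul, LinearMap.sum_apply, LinearMap.smul_apply, smul_eq_mul,
      hS.shiftedBilin_eigenvector hA]
  have h1 : shiftedBilin hA s u = ∑ j ∈ G, (lam j + shift Ω) * a j ^ 2 := by
    rw [hsw]
    exact Finset.sum_congr rfl fun j _ => by ring
  have h2 : shiftedBilin hA s s = ∑ j ∈ G, (lam j + shift Ω) * a j ^ 2 := by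
    rw [hsw]
    refine Finset.sum_congr rfl fun j hj => ?_
    have h3 : inner ℝ (toL2 hA (hS.eigenvector j)) (toL2 hA s) = a j := by
      rw [hs, map_sum]
      simp only [map_smul]
      exact (hS.orthonormal hA).inner_right_sum a hj
    rw [h3]
    ring
  have h4 : shiftedBilin hA u s = shiftedBilin hA s u := shiftedForm_symm _ _
  have h5 := shiftedBilin_self_nonneg hA (u - s)
  simp only [map_sub, LinearMap.sub_apply, h4, h1, h2] at h5
  linarith

/-- A lower bound for the form in terms of the eigenvalues below a threshold. -/
theorem IsEigenSystem.le_shiftedBilin (hS : IsEigenSystem Ω lam phi) (hA : Admissible Ω)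
    (u : memHSubmodule Ω) (F : Finset ℕ) {T : ℝ} (hF : ∀ j ∉ F, T ≤ lam j + shift Ω) :
    T * ‖toL2 hA u‖ ^ 2 - ∑ j ∈ F, (T - (lam j + shift Ω)) *
      inner ℝ (toL2 hA (hS.eigenvector j)) (toL2 hA u) ^ 2 ≤ shiftedBilin hA u u := by
  obtain ⟨b, hb⟩ := hS.exists_basis hA
  have hsum := b.hasSum_inner_mul_inner (toL2 hA u) (toL2 hA u)
  simp only [hb, real_inner_self_eq_norm_sq, real_inner_comm _ (toL2 hA u), ← sq] at hsum
  have hlim : Tendsto (fun G : Finset ℕ => T * (∑ j ∈ G,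
      inner ℝ (toL2 hA (hS.eigenvector j)) (toL2 hA u) ^ 2) -
      ∑ j ∈ F, (T - (lam j + shift Ω)) *
        inner ℝ (toL2 hA (hS.eigenvector j)) (toL2 hA u) ^ 2) atTop (𝓝 _) :=
    (Tendsto.const_mul T hsum).sub_const _
  -- Parseval is needed only for the `L²` norm; for the form, Bessel on each finite `G ⊇ F`
  -- suffices.
  refine le_of_tendsto hlim ?_
  filter_upwards [eventually_ge_atTop F] with G hG
  refine le_trans ?_ (hS.sum_le_shiftedBilin hA u G)
  rw [← Finset.sum_sdiff hG, ← Finset.sum_sdiff hG, mul_add, Finset.mul_sum, Finset.mul_sum,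
    add_sub_assoc, ← Finset.sum_sub_distrib]
  refine add_le_add (Finset.sum_le_sum fun j hj => ?_) (Finset.sum_le_sum fun j _ => ?_)
  · exact mul_le_mul_of_nonneg_right (hF j (Finset.mem_sdiff.mp hj).2) (sq_nonneg _)
  · apply le_of_eq
    ring

/-- Upper bound for the number of eigenvalues below `t`. -/
theorem IsEigenSystem.exists_ncard_le (hS : IsEigenSystem Ω lam phi) (hA : Admissible Ω) :
    ∃ C : ℝ, 0 < C ∧ ∀ t, {j | lam j < t}.Finite ∧
      ({j | lam j < t}.ncard : ℝ) ≤ C * Real.exp (N / 2 * max t 0) := by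
  obtain ⟨C, hC, hcount⟩ := exists_card_le hA
  -- The eigenfunctions are themselves an orthonormal family, with energies `λ_j`.
  have key : ∀ (t : ℝ) (F : Finset ℕ), (F : Set ℕ) ⊆ {j | lam j < t} →
      (F.card : ℝ) ≤ C * Real.exp (N / 2 * max t 0) := by
    intro t F hF
    let e := F.equivFin.symm
    refine hcount t F.card (fun k => hS.eigenvector (e k)) ?_ fun k => ?_
    · exact (hS.orthonormal hA).comp (fun k => (e k : ℕ))
        (Subtype.val_injective.comp e.injective)
    · have h1 := (hS.eigen (e k)).weak_eq _ (hS.eigen (e k)).memH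
      have h2 := inner_toL2 hA (hS.eigenvector (e k)) (hS.eigenvector (e k))
      rw [real_inner_self_eq_norm_sq, (hS.orthonormal hA).1, one_pow] at h2
      rw [(hS.eigen (e k)).memH.setIntegral_mul] at h1
      change logEnergy (phi (e k)) (phi (e k)) ≤ t
      change 1 = ∫ x, phi (e k) x * phi (e k) x at h2
      rw [h1, ← h2, mul_one]
      exact (hF (e k).2 : lam (e k) < t).le
  have hfin : ∀ t, {j | lam j < t}.Finite := fun t => by
    by_contra hinf
    obtain ⟨n, hn⟩ := exists_nat_gt (C * Real.exp (N / 2 * max t 0))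
    obtain ⟨F, hF, hcard⟩ := Set.Infinite.exists_subset_card_eq hinf n
    have := key t F hF
    rw [hcard] at this
    linarith
  refine ⟨C, hC, fun t => ⟨hfin t, ?_⟩⟩
  rw [Set.ncard_eq_toFinset_card _ (hfin t)]
  exact key t _ (by simp)

/-- Lower bound for the number of eigenvalues below `2 log m + C`. -/
theorem IsEigenSystem.exists_le_ncard (hS : IsEigenSystem Ω lam phi) (hA : Admissible Ω)
    (hΩ : IsOpen Ω) (hne : Ω.Nonempty) : ∃ C : ℝ, ∀ m : ℕ, 1 ≤ m →
      (m : ℝ) ^ N ≤ {j | lam j < 2 * Real.log m + C}.ncard * (2 * Real.log m + C + shift Ω) := by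
  obtain ⟨C, hC⟩ := exists_orthonormal_logEnergy_le hA hΩ hne
  obtain ⟨_, _, hcard⟩ := hS.exists_ncard_le hA
  -- The extra `1` puts each tent's shifted form at most `T - 1`. Summing over the `m^N` tents, the
  -- multiples of `T` cancel and `m^N` remains.
  refine ⟨C + 1, fun m hm => ?_⟩
  obtain ⟨φ, hφ, hφe⟩ := hC m hm
  set t := 2 * Real.log m + (C + 1) with ht
  set T := t + shift Ω with hT
  have hfin := (hcard t).1
  set F := hfin.toFinset with hF
  have hmem : ∀ j, j ∈ F ↔ lam j < t := fun j => by simp [hF]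
  have h1 : ∀ k, T - ∑ j ∈ F, (T - (lam j + shift Ω)) *
      inner ℝ (toL2 hA (hS.eigenvector j)) (toL2 hA (φ k)) ^ 2 ≤ T - 1 := by
    intro k
    have h2 := hS.le_shiftedBilin hA (φ k) F (T := T) fun j hj => by
      rw [hmem, not_lt] at hj
      linarith
    rw [hφ.1 k, one_pow, mul_one] at h2
    refine h2.trans ?_
    have h3 := inner_toL2 hA (φ k) (φ k)
    rw [real_inner_self_eq_norm_sq, hφ.1 k, one_pow] at h3
    change logEnergy (φ k).1 (φ k).1 + shift Ω * ∫ x, (φ k).1 x * (φ k).1 x ≤ _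
    rw [← h3]
    have := hφe k
    linarith
  have h4 := Finset.sum_le_sum fun k (_ : k ∈ Finset.univ) => h1 k
  rw [Finset.sum_sub_distrib, Finset.sum_comm] at h4
  simp only [Finset.sum_const, Finset.card_univ, Fintype.card_fun, Fintype.card_fin,
    nsmul_eq_mul, ← Finset.mul_sum] at h4
  -- Bessel over the tents bounds each inner sum by `1`, and `λ_j + shift Ω ≥ 0` bounds its weight
  -- by `T`.
  have h5 : ∑ j ∈ F, (T - (lam j + shift Ω)) *
      ∑ k, inner ℝ (toL2 hA (hS.eigenvector j)) (toL2 hA (φ k)) ^ 2 ≤ ∑ _j ∈ F, T := by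
    refine Finset.sum_le_sum fun j hj => ?_
    rw [hmem] at hj
    have h6 := hφ.sum_inner_products_le (toL2 hA (hS.eigenvector j)) (s := Finset.univ)
    rw [(hS.orthonormal hA).1, one_pow] at h6
    simp only [Real.norm_eq_abs, sq_abs, real_inner_comm (toL2 hA (hS.eigenvector j))] at h6
    have h7 := hS.add_shift_nonneg hA j
    calc _ ≤ (T - (lam j + shift Ω)) * 1 := mul_le_mul_of_nonneg_left h6 (by linarith)
      _ ≤ T := by linarith
  rw [Finset.sum_const, nsmul_eq_mul] at h5
  rw [Set.ncard_eq_toFinset_card _ hfin]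
  push_cast at h4
  linarith

theorem counting_eq {t : ℝ} (h : {j | lam j < t}.Finite) :
    counting lam t = ENNReal.ofReal {j | lam j < t}.ncard := by
  rw [counting, ← h.cast_ncard_eq]
  simp

theorem IsEigenSystem.tendsto_zero (hS : IsEigenSystem Ω lam phi) (hA : Admissible Ω) {δ : ℝ}
    (hδ : 0 < δ) : Tendsto (fun t : ℝ => counting lam t *
      ENNReal.ofReal (Real.exp (-((N : ℝ) / 2 + δ) * t))) atTop (𝓝 0) := by
  obtain ⟨C, hC, hcard⟩ := hS.exists_ncard_le hA
  have hlim : Tendsto (fun t : ℝ => ENNReal.ofReal (C * Real.exp (-(δ * t)))) atTop (𝓝 0) := by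
    rw [← ENNReal.ofReal_zero, ← mul_zero C]
    refine ENNReal.tendsto_ofReal (Tendsto.const_mul C ?_)
    exact Real.tendsto_exp_neg_atTop_nhds_zero.comp (tendsto_id.const_mul_atTop hδ)
  refine tendsto_of_tendsto_of_tendsto_of_le_of_le' tendsto_const_nhds hlim
    (Eventually.of_forall fun _ => zero_le) ?_
  filter_upwards [eventually_ge_atTop 0] with t ht
  rw [counting_eq (hcard t).1, ← ENNReal.ofReal_mul (by positivity)]
  refine ENNReal.ofReal_le_ofReal ?_
  have h1 := (hcard t).2
  rw [max_eq_left ht] at h1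
  calc _ ≤ C * Real.exp (N / 2 * t) * Real.exp (-((N : ℝ) / 2 + δ) * t) :=
        mul_le_mul_of_nonneg_right h1 (Real.exp_pos _).le
    _ = C * Real.exp (-(δ * t)) := by
        rw [mul_assoc, ← Real.exp_add]
        congr 2
        ring

theorem IsEigenSystem.tendsto_top (hS : IsEigenSystem Ω lam phi) (hA : Admissible Ω)
    (hΩ : IsOpen Ω) (hne : Ω.Nonempty) {δ : ℝ} (hδ : 0 < δ) :
    Tendsto (fun t : ℝ => counting lam t *
      ENNReal.ofReal (Real.exp (-((N : ℝ) / 2 - δ) * t))) atTop (𝓝 ⊤) := by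
  obtain ⟨_, _, hcard⟩ := hS.exists_ncard_le hA
  obtain ⟨C, hlow⟩ := hS.exists_le_ncard hA hΩ hne
  set s := shift Ω with hs
  -- `(1/2)^N` pays for the integer part in `m ≥ x/2`, the exponential for the constant `C` in `x =
  -- e^{(t-C)/2}`.
  set c : ℝ := (1 / 2) ^ N * Real.exp (-(N / 2 * C)) with hc
  have hc0 : 0 < c := by positivity
  have hlim : Tendsto (fun t : ℝ => ENNReal.ofReal (c * (δ / 2) * (Real.exp (δ * t) / (δ * t) ^ 1)))
      atTop (𝓝 ⊤) := by
    refine ENNReal.tendsto_ofReal_atTop.comp (Tendsto.const_mul_atTop (by positivity) ?_)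
    exact (Real.tendsto_exp_div_pow_atTop 1).comp (tendsto_id.const_mul_atTop hδ)
  refine tendsto_nhds_top_mono hlim ?_
  filter_upwards [eventually_ge_atTop 1, eventually_ge_atTop C, eventually_ge_atTop s]
    with t ht1 htC hts
  rw [counting_eq (hcard t).1, ← ENNReal.ofReal_mul (by positivity)]
  refine ENNReal.ofReal_le_ofReal ?_
  -- This makes `m = ⌊x⌋` essentially the largest integer with `2 log m + C ≤ t`. Here `t ≥ C`
  -- ensures `m ≥ 1`, and `t ≥ s` bounds the lost factor by `2t`.
  set x := Real.exp ((t - C) / 2) with hx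
  have hx1 : 1 ≤ x := Real.one_le_exp (by linarith)
  set m := ⌊x⌋₊ with hm
  have hm1 : 1 ≤ m := Nat.le_floor (by exact_mod_cast hx1)
  have hm1' : (1 : ℝ) ≤ m := by exact_mod_cast hm1
  have hmx : (m : ℝ) ≤ x := Nat.floor_le (by positivity)
  have hxm : x / 2 ≤ m := by
    have := Nat.lt_floor_add_one x
    linarith
  have hlog : 2 * Real.log m + C ≤ t := by
    have h1 : Real.log m ≤ Real.log x := Real.log_le_log (by positivity) hmx
    rw [hx, Real.log_exp] at h1
    linarith
  have h2 := hlow m hm1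
  set n : ℕ := {j | lam j < t}.ncard with hn
  have h3 : {j | lam j < 2 * Real.log m + C}.ncard ≤ n :=
    Set.ncard_le_ncard (fun j hj => lt_of_lt_of_le hj hlog) (hcard t).1
  have h3' : ({j | lam j < 2 * Real.log m + C}.ncard : ℝ) ≤ n := by exact_mod_cast h3
  have h4 : (m : ℝ) ^ N ≤ n * (2 * t) := by
    have h5 : (0 : ℝ) ≤ {j | lam j < 2 * Real.log m + C}.ncard := by positivity
    calc _ ≤ _ := h2
      _ ≤ ({j | lam j < 2 * Real.log m + C}.ncard : ℝ) * (2 * t) :=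
        mul_le_mul_of_nonneg_left (by linarith) h5
      _ ≤ n * (2 * t) := mul_le_mul_of_nonneg_right h3' (by linarith)
  have h6 : c * Real.exp (N / 2 * t) ≤ n * (2 * t) := by
    refine le_trans (le_of_eq ?_) ((pow_le_pow_left₀ (by positivity) hxm N).trans h4)
    rw [hc, div_eq_mul_one_div x 2, mul_pow, hx, ← Real.exp_nat_mul, mul_assoc, ← Real.exp_add,
      mul_comm]
    congr 2
    ring
  have h7 : Real.exp (δ * t) = Real.exp (N / 2 * t) * Real.exp (-((N : ℝ) / 2 - δ) * t) := by
    rw [← Real.exp_add]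
    congr 1
    ring
  have h8 := mul_le_mul_of_nonneg_right h6 (Real.exp_pos (-((N : ℝ) / 2 - δ) * t)).le
  rw [mul_assoc, ← h7] at h8
  rw [pow_one]
  have h9 : c * (δ / 2) * (Real.exp (δ * t) / (δ * t)) = c * Real.exp (δ * t) / (2 * t) := by
    field_simp
  rw [h9, div_le_iff₀ (by linarith)]
  linarith

end Asymptotics

end LogLaplacian

end

/-! ### Conclusion -/

theorem mainTheorem7 (N : ℕ) (hN : 1 ≤ N) (Ω : Set (EuclideanSpace ℝ (Fin N)))
    (hΩ_open : IsOpen Ω) (hΩ_conn : IsConnected Ω) (hΩ_bdd : Bornology.IsBounded Ω) :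
    (∃ (lam : ℕ → ℝ) (phi : ℕ → EuclideanSpace ℝ (Fin N) → ℝ),
      LogLaplacian.IsEigenSystem Ω lam phi) ∧
    ∀ (lam : ℕ → ℝ) (phi : ℕ → EuclideanSpace ℝ (Fin N) → ℝ),
      LogLaplacian.IsEigenSystem Ω lam phi →
      (∀ t : ℝ, LogLaplacian.counting lam t ≠ ⊤) ∧
      ∀ δ : ℝ, 0 < δ →
        Tendsto (fun t : ℝ => LogLaplacian.counting lam t *
            ENNReal.ofReal (Real.exp (-((N : ℝ) / 2 + δ) * t))) atTop (𝓝 0) ∧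
        liminf (fun t : ℝ => LogLaplacian.counting lam t *
            ENNReal.ofReal (Real.exp (-((N : ℝ) / 2 - δ) * t))) atTop = ⊤ := by
  have hA : LogLaplacian.Admissible Ω := ⟨hN, hΩ_open.measurableSet, hΩ_bdd⟩
  refine ⟨LogLaplacian.exists_isEigenSystem hA hΩ_open hΩ_conn.nonempty, fun lam phi hS => ?_⟩
  obtain ⟨_, _, hcard⟩ := hS.exists_ncard_le hA
  refine ⟨fun t => ?_, fun δ hδ => ⟨hS.tendsto_zero hA hδ,
    (hS.tendsto_top hA hΩ_open hΩ_conn.nonempty hδ).liminf_eq⟩⟩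
  rw [LogLaplacian.counting_eq (hcard t).1]
  exact ENNReal.ofReal_ne_top
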